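/- All graphs are finite, without loops or parallel edges. Fix an integer $\ell\ge 5$. The length of a path or cycle is its number of edges, and a path may consist of a single vertex; $P$ is odd (even) if its length is. A path or hole is long if its length is at least $\ell$. A hole of $G$ is an induced subgraph of $G$ that is a cycle of length at least four; a shortest long odd hole is a long odd hole of minimum length. The interior of a path is the set of its vertices that are not ends. A long jewel of order $\max(|V(Q_1)|,|V(Q_2)|)$ consists of three induced paths $Q_1,Q_2,P$ of $G$ between the same two vertices, where $Q_1,Q_2$ have different parity, $P$ is long, and no vertex of the interior of $P$ equals or is adjacent to a vertex of the interior of $Q_1$ or of $Q_2$. A long pyramid consists of induced paths $P_1,P_2,P_3$ of $G$, where $P_i$ is between $a$ and $b_i\neq a$, such that the paths are pairwise vertex-disjoint except for $a$, at least two of them are long, $b_1,b_2,b_3$ are pairwise adjacent, and for $i\ne j$ the only edge between $V(P_i)\setminus\{a\}$ and $V(P_j)\setminus\{a\}$ is $b_ib_j$. The graph $G$ is a candidate if it contains no long pyramid, no long jewel of order at most $\ell+2$, and no long odd hole of length at most $2\ell+2$. Let $C$ be a shortest long odd hole in $G$. A path of $C$ is a path that is a subgraph of $C$. A vertex $v\notin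 V(C)$ is $C$-major if no three-vertex path of $C$ contains all neighbours of $v$ in $V(C)$. For distinct $C$-major vertices $u,v$, a $(u,v)$-gap is a path $P$ of $C$ such that $V(P)$ is the interior of an induced path between $u$ and $v$ in $G$ (if $u,v$ are nonadjacent) or in the graph obtained from $G$ by deleting the edge $uv$ (if $u,v$ are adjacent). A base is a pair $(x,D)$ where $x$ is $C$-major, $D$ is a path of $C$, $x$ is adjacent to the ends of $D$ and to no internal vertex of $D$, and $D$ is maximal under inclusion among all paths of $C$ that have this property for some $C$-major vertex. The base $(x,D)$ is remote if $D$ has length at least $2\ell$ and no $C$-major vertex other than $x$ has a neighbour $w\in V(C)$ whose distance in $C$ from an end of $D$ is less than $\ell$. If $G$ is a candidate, $(x,D)$ is a remote base and $v$ is a $C$-major vertex nonadjacent to $x$ and different from $x$, then $(x,v)$-gaps exist and all have the same parity; this is called the $x$-parity of $v$. A path $P$ of $C$ catches a vertex $v$ if $v\notin V(P)$ and $v$ is adjacent to an internal vertex of $P$; a set of paths of $C$ catches $v$ if one of its members does, and its cost is the number of vertices in the union of its members. Theorem 6.1 (cleanoutadj). Let $C$ be a shortest long odd hole in a candidate $G$,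 and let $(x,D)$ be a remote base. Let $M$ be a set of $C$-major vertices, all different from and nonadjacent to $x$ and with the same $x$-parity. Let $v_1,v_2\in M$ be adjacent, and let $Q$ be an odd $(v_1,v_2)$-gap, with ends $q_1,q_2$, edge-disjoint from $D$, where $v_i,q_i$ are adjacent for $i=1,2$. Suppose that $x$ has a neighbour in $V(Q)$ and every vertex in $M$ has a neighbour in $V(Q)$. Then there is a set of paths of $C$ with cost at most $5\ell+12$ that catches all the vertices in $M$. -/

import Mathlib

namespace LongOddHole

open SimpleGraph

variable {V : Type*} {G : SimpleGraph V}

/-- `p` is an induced path of `G` (its length is `p.length`, its number of edges). -/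
def IsInducedPath {u v : V} (p : G.Walk u v) : Prop :=
  p.IsPath ∧ p.IsChordless

/-- The set of vertices of the path `p` that are not ends of `p`. -/
def interior {u v : V} (p : G.Walk u v) : Set V :=
  {w | w ∈ p.support ∧ w ≠ u ∧ w ≠ v}

/-- A hole: an induced cycle of length at least four, traversed from an arbitrary vertex. -/
def IsHole {c : V} (C : G.Walk c c) : Prop :=
  C.IsCycle ∧ C.IsChordless ∧ 4 ≤ C.length

/-- A hole of odd length at least `ℓ`. -/
def IsLongOddHole (ℓ : ℕ) {c : V} (C : G.Walk c c) : Prop :=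
  IsHole C ∧ ℓ ≤ C.length ∧ Odd C.length

/-- A long odd hole of minimum length. -/
def IsShortestLongOddHole (ℓ : ℕ) {c : V} (C : G.Walk c c) : Prop :=
  IsLongOddHole ℓ C ∧
    ∀ (c' : V) (C' : G.Walk c' c'), IsLongOddHole ℓ C' → C.length ≤ C'.length

/-- `P` is a path of `C`: a path whose vertices and edges are vertices and edges of `C`. -/
def IsPathOf {c : V} (C : G.Walk c c) {a b : V} (P : G.Walk a b) : Prop :=
  P.IsPath ∧ P.support ⊆ C.support ∧ P.edges ⊆ C.edges

/-- `v` is `C`-major: it is not in `C`, and no three-vertex path of `C` contains all the neighbours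
of `v` in `C`. -/
def IsMajor {c : V} (C : G.Walk c c) (v : V) : Prop :=
  v ∉ C.support ∧
    ¬ ∃ (a b : V) (P : G.Walk a b), IsPathOf C P ∧ P.length = 2 ∧
      ∀ w ∈ C.support, G.Adj v w → w ∈ P.support

/-- `G` contains a long jewel of order at most `k`, formed by `Q₁`, `Q₂`, `P`; a path has one more
vertex than its length. -/
def HasLongJewel (G : SimpleGraph V) (ℓ k : ℕ) : Prop :=
  ∃ (u v : V) (Q₁ Q₂ P : G.Walk u v),
    IsInducedPath Q₁ ∧ IsInducedPath Q₂ ∧ IsInducedPath P ∧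
    ¬ (Even Q₁.length ↔ Even Q₂.length) ∧
    ℓ ≤ P.length ∧
    (∀ a ∈ interior P, ∀ b ∈ interior Q₁ ∪ interior Q₂, a ≠ b ∧ ¬ G.Adj a b) ∧
    max (Q₁.length + 1) (Q₂.length + 1) ≤ k

/-- `G` contains a long pyramid, with apex `a` and base `{b 0, b 1, b 2}`, formed by
`P 0`, `P 1`, `P 2`. -/
def HasLongPyramid (G : SimpleGraph V) (ℓ : ℕ) : Prop :=
  ∃ (a : V) (b : Fin 3 → V) (P : ∀ i, G.Walk a (b i)),
    (∀ i, IsInducedPath (P i)) ∧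
    (∀ i j, i ≠ j → ∀ w, w ∈ (P i).support → w ∈ (P j).support → w = a) ∧
    (∀ i, b i ≠ a) ∧
    (∃ i j, i ≠ j ∧ ℓ ≤ (P i).length ∧ ℓ ≤ (P j).length) ∧
    (∀ i j, i ≠ j → G.Adj (b i) (b j)) ∧
    (∀ i j, i ≠ j → ∀ w ∈ (P i).support, ∀ z ∈ (P j).support, w ≠ a → z ≠ a →
      G.Adj w z → w = b i ∧ z = b j)

/-- `G` is a candidate: it contains no long pyramid, no long jewel of order at most `ℓ + 2`, and no
long odd hole of length at most `2ℓ + 2`. -/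
def IsCandidate (G : SimpleGraph V) (ℓ : ℕ) : Prop :=
  ¬ HasLongPyramid G ℓ ∧ ¬ HasLongJewel G ℓ (ℓ + 2) ∧
    ¬ ∃ (c : V) (C : G.Walk c c), IsLongOddHole ℓ C ∧ C.length ≤ 2 * ℓ + 2

/-- `P` is a `(u, v)`-gap, for distinct `C`-major vertices `u`, `v`: a path of `C` whose vertex set
is the interior of an induced path between `u` and `v` in `G` with the edge `uv` deleted (if `u`
and `v` are nonadjacent, this graph is `G` itself). -/
def IsGap {c : V} (C : G.Walk c c) (u v : V) {a b : V} (P : G.Walk a b) : Prop :=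
  u ≠ v ∧ IsPathOf C P ∧
    ∃ R : (G.deleteEdges {s(u, v)}).Walk u v,
      IsInducedPath R ∧ interior R = {w | w ∈ P.support}

/-- `D` is a path of `C` such that `x` is adjacent to its ends and to none of its internal
vertices. -/
def IsSpanned {c : V} (C : G.Walk c c) (x : V) {d₁ d₂ : V} (D : G.Walk d₁ d₂) : Prop :=
  IsPathOf C D ∧ G.Adj x d₁ ∧ G.Adj x d₂ ∧ ∀ w ∈ interior D, ¬ G.Adj x w

/-- `(x, D)` is a base: `x` is `C`-major, `x` is adjacent to the ends of `D` and to no internal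
vertex of `D`, and `D` is maximal under inclusion among all paths of `C` that have this property
for some `C`-major vertex. -/
def IsBase {c : V} (C : G.Walk c c) (x : V) {d₁ d₂ : V} (D : G.Walk d₁ d₂) : Prop :=
  IsMajor C x ∧ IsSpanned C x D ∧
    ∀ (y e₁ e₂ : V) (E : G.Walk e₁ e₂), IsMajor C y → IsSpanned C y E →
      D.support ⊆ E.support → D.edges ⊆ E.edges → E.length ≤ D.length

/-- The base `(x, D)` is remote: `D` has length at least `2ℓ`, and no `C`-major vertex other than
`x` has a neighbour in `C` at distance less than `ℓ` (measured in `C`) from an end of `D`. -/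
def IsRemoteBase (ℓ : ℕ) {c : V} (C : G.Walk c c) (x : V) {d₁ d₂ : V} (D : G.Walk d₁ d₂) : Prop :=
  IsBase C x D ∧ 2 * ℓ ≤ D.length ∧
    ∀ y, IsMajor C y → y ≠ x → ∀ w ∈ C.support, G.Adj y w →
      (¬ ∃ P : G.Walk w d₁, IsPathOf C P ∧ P.length < ℓ) ∧
      (¬ ∃ P : G.Walk w d₂, IsPathOf C P ∧ P.length < ℓ)

/-- `p` is the `x`-parity of `v`. All `(x, v)`-gaps have the same parity when `(x, D)` is a remote
base and `v` is a `C`-major vertex nonadjacent to `x`; as that is a theorem, it is not built into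
the definition, which only asks for one `(x, v)`-gap with parity `p`. -/
def HasXParity {c : V} (C : G.Walk c c) (x v : V) (p : ZMod 2) : Prop :=
  ∃ (a b : V) (P : G.Walk a b), IsGap C x v P ∧ (P.length : ZMod 2) = p

/-- `P` catches `v`. -/
def Catches {a b : V} (P : G.Walk a b) (v : V) : Prop :=
  v ∉ P.support ∧ ∃ w ∈ interior P, G.Adj v w

/-- The cost of a set of paths: the number of vertices in the union of the paths. -/
noncomputable def cost (F : Set (Σ a b : V, G.Walk a b)) : ℕ :=
  {w : V | ∃ P ∈ F, w ∈ P.2.2.support}.ncard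

end LongOddHole

/-! ### Induced paths tracked by vertex set and length, and the forbidden configurations. -/

namespace LongOddHole

open SimpleGraph

variable {V : Type*} {G : SimpleGraph V}

/-! Number $C$ by integers modulo its odd length `n`, with `D` as the arc `[0, δ]`. Every long hole
shorter than $C$ is even. Hence two gaps between the same nonadjacent vertices that are far apart on
$C$ have equal parity, provided the hole they close is long and shorter than $C$. In particular `δ`
is even, and all gaps between `x` and a given member of `M` have one parity (`Setup.even_gap_iff`).

Let `u`, `v` in `M` have gaps to `x` inside $Q$, each free of neighbours of the other vertex, and
let `f`, `g` be the positions of their first neighbours in `D`. If the two gaps are apart, an odd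
path between `u` and `v` inside `D`, avoiding the part up to the earlier first neighbour, completes
them to an odd hole. If that hole is too short to be long, there is a long jewel whose long path
runs along the beginning of `D` (`Setup.no_odd_detour`). So when `f` and `g` differ by at least two,
`u` and `v` are nonadjacent and have an even gap inside `D` (`Setup.exists_even_gap`). If the two
gaps are consecutive and one is long, there is a long pyramid based on `x` and the two touching
vertices, unless `f` and `g` differ by at most one (`Setup.not_far_of_touch`).

Now let $Q$ be the arc `[s, t]`, and `x₁`, `x₂` the first and last neighbours of `x` in it. The gaps
`[s, x₁]` and `[x₂, t]` have equal parity and `t - s` is odd, so `x₂ - x₁` is odd. If `x₂ = x₁ + 1`,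
the pyramids show that arcs around this pair and around the first neighbours of `v₁`, `v₂` catch all
of `M`. Otherwise the hole through `x`, `v₁`, `v₂` is odd, hence short, so `x₁` is near `s` and `x₂`
near `t`. A member not caught near `s`, `t` or those first neighbours then has exactly two
neighbours in $Q$, at `h` and `h + 1`, with `h - s` even (`Setup.exists_pair_of_uncaught`). Two such
members with distant pairs and distant first neighbours would have an odd gap between the pairs and
an even one in `D` (`Setup.pairs_close`). So one arc around `h` and one around the first neighbour
of a single such member catch all the others. -/

/-- There is an induced path between `a` and `b` with vertex set `S` and length `k`. -/
def IPath (G : SimpleGraph V) (S : Set V) (a b : V) (k : ℤ) : Prop :=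
  ∃ p : G.Walk a b, IsInducedPath p ∧ (∀ w, w ∈ p.support ↔ w ∈ S) ∧ (p.length : ℤ) = k

namespace IPath

variable {S T : Set V} {a b c d v : V} {k m : ℤ}

lemma single (v : V) : IPath G {v} v v 0 := by
  refine ⟨Walk.nil, ⟨Walk.IsPath.nil, ?_⟩, by simp, by simp⟩
  rw [Walk.isChordless_iff_forall_mem_edges]
  intro u' v' hu hv h
  simp only [Walk.support_nil, List.mem_singleton] at hu hv
  subst hu; subst hv
  exact absurd h (G.loopless.irrefl _)

lemma nonneg (h : IPath G S a b k) : 0 ≤ k := by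
  obtain ⟨p, -, -, hl⟩ := h
  omega

lemma ne_of_pos (h : IPath G S a b k) (hk : 0 < k) : a ≠ b := by
  obtain ⟨p, hp, -, hl⟩ := h
  rintro rfl
  have := Walk.length_eq_zero_iff.2 (Walk.isPath_iff_nil.1 hp.1)
  omega

lemma symm (h : IPath G S a b k) : IPath G S b a k := by
  obtain ⟨p, hp, hs, hl⟩ := h
  refine ⟨p.reverse, ⟨hp.1.reverse, ?_⟩, by simpa using hs, by simpa using hl⟩
  have h2 := hp.2
  rw [Walk.isChordless_iff_forall_mem_edges] at h2 ⊢
  simpa using h2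

/-- The holes, jewels and pyramids below are assembled with this lemma: inducedness reduces to
inspecting pairs across the two vertex sets. The extra 1 in the length is the joining edge. -/
lemma join (h₁ : IPath G S a b k) (h₂ : IPath G T c d m) (hbc : G.Adj b c)
    (hd : ∀ s ∈ S, ∀ t ∈ T, s ≠ t ∧ (G.Adj s t → s = b ∧ t = c)) :
    IPath G (S ∪ T) a d (k + m + 1) := by
  obtain ⟨p, hp, hs, hl⟩ := h₁
  obtain ⟨q, hq, ht, hm⟩ := h₂
  have hsupp : (p.append (Walk.cons hbc q)).support = p.support ++ q.support := by
    simp [Walk.support_append]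
  refine ⟨p.append (Walk.cons hbc q), ⟨?_, ?_⟩, ?_, ?_⟩
  · rw [Walk.isPath_def, hsupp, List.nodup_append]
    refine ⟨hp.1.support_nodup, hq.1.support_nodup, ?_⟩
    intro s h1 t h2
    exact (hd s ((hs s).1 h1) t ((ht t).1 h2)).1
  · have h2 := hp.2
    have h3 := hq.2
    rw [Walk.isChordless_iff_forall_mem_edges] at h2 h3 ⊢
    intro s t h4 h5 h
    rw [hsupp, List.mem_append] at h4 h5
    simp only [Walk.edges_append, Walk.edges_cons, List.mem_append, List.mem_cons]
    rcases h4 with h4 | h4 <;> rcases h5 with h5 | h5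
    · exact Or.inl (h2 h4 h5 h)
    · obtain ⟨rfl, rfl⟩ := (hd s ((hs s).1 h4) t ((ht t).1 h5)).2 h
      simp
    · obtain ⟨rfl, rfl⟩ := (hd t ((hs t).1 h5) s ((ht s).1 h4)).2 h.symm
      right; left; exact Sym2.eq_swap
    · exact Or.inr (Or.inr (h3 h4 h5 h))
  · intro w
    rw [hsupp, List.mem_append, hs, ht, Set.mem_union]
  · simp only [Walk.length_append, Walk.length_cons]
    push_cast
    omega

/-- Extend an induced path by one vertex at its end. -/
lemma snoc (h : IPath G S a b k) (hv : v ∉ S) (hbv : G.Adj b v)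
    (hd : ∀ s ∈ S, G.Adj s v → s = b) : IPath G (S ∪ {v}) a v (k + 1) := by
  have := h.join (single v) hbv (by
    intro s hs t ht
    rw [Set.mem_singleton_iff] at ht
    subst ht
    exact ⟨fun e => hv (e ▸ hs), fun h' => ⟨hd s hs h', rfl⟩⟩)
  simpa using this

end IPath

/-- The closed walk is a hole of length `k + 2`; if odd, it would be a long odd hole shorter than
`C`. -/
lemma IsShortestLongOddHole.even_of_closing {ℓ : ℕ} {c₀ : V} {C : G.Walk c₀ c₀}
    (hC : IsShortestLongOddHole ℓ C) {S : Set V} {a b z : V} {k : ℤ} (h : IPath G S a b k)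
    (hz : z ∉ S) (ha : G.Adj z a) (hb : G.Adj z b)
    (hd : ∀ s ∈ S, G.Adj z s → s = a ∨ s = b) (h2 : 2 ≤ k) (hl : ℓ ≤ k + 2)
    (hn : k + 2 < C.length) : Even k := by
  have hab : a ≠ b := h.ne_of_pos (by omega)
  obtain ⟨p, hp, hs, hk⟩ := h
  by_contra hodd
  have hle := hC.2 z (Walk.cons ha (p.concat hb.symm)) ⟨⟨?_, ?_, ?_⟩, ?_, ?_⟩
  · simp only [Walk.length_cons, Walk.length_concat] at hle
    omega
  · rw [Walk.cons_isCycle_iff]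
    refine ⟨hp.1.concat (by rwa [hs]) _, ?_⟩
    rw [Walk.edges_concat, List.concat_eq_append, List.mem_append]
    rintro (h' | h')
    · exact hz ((hs z).1 (p.fst_mem_support_of_mem_edges h'))
    · rw [List.mem_singleton, Sym2.eq_iff] at h'
      rcases h' with ⟨rfl, h'⟩ | ⟨-, h'⟩
      · exact G.loopless.irrefl _ hb
      · exact hab h'
  · have h3 := hp.2
    rw [Walk.isChordless_iff_forall_mem_edges] at h3 ⊢
    intro s t h4 h5 hst
    simp only [Walk.support_cons, Walk.support_concat, List.mem_append,
      List.mem_cons, List.not_mem_nil, or_false] at h4 h5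
    simp only [Walk.edges_cons, Walk.edges_concat, List.concat_eq_append, List.mem_append,
      List.mem_cons, List.not_mem_nil, or_false]
    have key : ∀ t, t ∈ p.support → G.Adj z t → s(z, t) = s(z, a) ∨ s(z, t) ∈ p.edges ∨
        s(z, t) = s(b, z) := by
      intro t ht hzt
      rcases hd t ((hs t).1 ht) hzt with rfl | rfl
      · simp
      · right; right; exact Sym2.eq_swap
    have h4' : s = z ∨ s ∈ p.support := by tauto
    have h5' : t = z ∨ t ∈ p.support := by tauto
    rcases h4' with rfl | h4' <;> rcases h5' with rfl | h5'
    · exact absurd hst (G.loopless.irrefl _)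
    · exact key t h5' hst
    · rw [Sym2.eq_swap (a := s)]
      exact key s h4' hst.symm
    · exact Or.inr (Or.inl (h3 h4' h5' hst))
  · simp only [Walk.length_cons, Walk.length_concat]
    omega
  · simp only [Walk.length_cons, Walk.length_concat]
    omega
  · simp only [Walk.length_cons, Walk.length_concat]
    rw [Int.not_even_iff_odd] at hodd
    have : Odd (p.length : ℤ) := hk ▸ hodd
    rw [Int.odd_coe_nat] at this
    simpa [Nat.odd_add_one, parity_simps] using this

/-- Disjointness and the edge condition are merged and asked only once for each pair of paths; the
two paths required to be long come first. -/
lemma not_hasLongPyramid_paths {ℓ : ℕ} (hG : ¬ HasLongPyramid G ℓ) {a b₀ b₁ b₂ : V}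
    {S₀ S₁ S₂ : Set V} {k₀ k₁ k₂ : ℤ} (h₀ : IPath G S₀ a b₀ k₀) (h₁ : IPath G S₁ a b₁ k₁)
    (h₂ : IPath G S₂ a b₂ k₂) (n₀ : b₀ ≠ a) (n₁ : b₁ ≠ a) (n₂ : b₂ ≠ a)
    (a₀₁ : G.Adj b₀ b₁) (a₀₂ : G.Adj b₀ b₂) (a₁₂ : G.Adj b₁ b₂) (l₀ : ℓ ≤ k₀) (l₁ : ℓ ≤ k₁)
    (d₀₁ : ∀ s ∈ S₀, ∀ t ∈ S₁, s ≠ a → t ≠ a → s ≠ t ∧ (G.Adj s t → s = b₀ ∧ t = b₁))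
    (d₀₂ : ∀ s ∈ S₀, ∀ t ∈ S₂, s ≠ a → t ≠ a → s ≠ t ∧ (G.Adj s t → s = b₀ ∧ t = b₂))
    (d₁₂ : ∀ s ∈ S₁, ∀ t ∈ S₂, s ≠ a → t ≠ a → s ≠ t ∧ (G.Adj s t → s = b₁ ∧ t = b₂)) :
    False := by
  obtain ⟨p₀, i₀, s₀, m₀⟩ := h₀
  obtain ⟨p₁, i₁, s₁, m₁⟩ := h₁
  obtain ⟨p₂, i₂, s₂, m₂⟩ := h₂
  let b : Fin 3 → V := ![b₀, b₁, b₂]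
  let P : ∀ i, G.Walk a (b i) := Fin.cons p₀ (Fin.cons p₁ (Fin.cons p₂ finZeroElim))
  let S : Fin 3 → Set V := ![S₀, S₁, S₂]
  have hS : ∀ i w, w ∈ (P i).support ↔ w ∈ S i := by
    intro i
    fin_cases i
    · exact s₀
    · exact s₁
    · exact s₂
  have hd : ∀ i j, i ≠ j → ∀ s ∈ S i, ∀ t ∈ S j, s ≠ a → t ≠ a →
      s ≠ t ∧ (G.Adj s t → s = b i ∧ t = b j) := by
    intro i j hij
    fin_cases i <;> fin_cases j <;> first | exact absurd rfl hij | skip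
    · exact d₀₁
    · exact d₀₂
    · intro s hs t ht h1 h2
      have := d₀₁ t ht s hs h2 h1
      exact ⟨this.1.symm, fun h => (this.2 h.symm).symm⟩
    · exact d₁₂
    · intro s hs t ht h1 h2
      have := d₀₂ t ht s hs h2 h1
      exact ⟨this.1.symm, fun h => (this.2 h.symm).symm⟩
    · intro s hs t ht h1 h2
      have := d₁₂ t ht s hs h2 h1
      exact ⟨this.1.symm, fun h => (this.2 h.symm).symm⟩
  apply hG
  refine ⟨a, b, P, ?_, ?_, ?_, ⟨0, 1, by decide, ?_, ?_⟩, ?_, ?_⟩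
  · intro i
    fin_cases i
    · exact i₀
    · exact i₁
    · exact i₂
  · intro i j hij w h1 h2
    by_contra hw
    exact (hd i j hij w ((hS i w).1 h1) w ((hS j w).1 h2) hw hw).1 rfl
  · intro i
    fin_cases i
    · exact n₀
    · exact n₁
    · exact n₂
  · have : ℓ ≤ p₀.length := by omega
    exact this
  · have : ℓ ≤ p₁.length := by omega
    exact this
  · intro i j hij
    fin_cases i <;> fin_cases j <;> first | exact absurd rfl hij | skip
    · exact a₀₁
    · exact a₀₂
    · exact a₀₁.symm
    · exact a₁₂
    · exact a₀₂.symm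
    · exact a₁₂.symm
  · intro i j hij w h1 z h2 hw hz h
    exact (hd i j hij w ((hS i w).1 h1) z ((hS j z).1 h2) hw hz).2 h

lemma not_hasLongJewel_paths {ℓ k : ℕ} (hG : ¬ HasLongJewel G ℓ k) {u v : V}
    {S₁ S₂ S : Set V} {k₁ k₂ m : ℤ} (h₁ : IPath G S₁ u v k₁) (h₂ : IPath G S₂ u v k₂)
    (h : IPath G S u v m) (hp : ¬ (Even k₁ ↔ Even k₂)) (hm : ℓ ≤ m)
    (hd : ∀ s ∈ S, s ≠ u → s ≠ v → ∀ t ∈ S₁ ∪ S₂, t ≠ u → t ≠ v → s ≠ t ∧ ¬ G.Adj s t)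
    (l₁ : k₁ + 1 ≤ k) (l₂ : k₂ + 1 ≤ k) : False := by
  obtain ⟨p₁, i₁, s₁, m₁⟩ := h₁
  obtain ⟨p₂, i₂, s₂, m₂⟩ := h₂
  obtain ⟨p, i, s, hl⟩ := h
  apply hG
  refine ⟨u, v, p₁, p₂, p, i₁, i₂, i, ?_, by omega, ?_, ?_⟩
  · rwa [← m₁, ← m₂, Int.even_coe_nat, Int.even_coe_nat] at hp
  · rintro a ⟨ha, h1, h2⟩ b hb
    refine hd a ((s a).1 ha) h1 h2 b ?_ ?_ ?_
    · rcases hb with ⟨hb, -, -⟩ | ⟨hb, -, -⟩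
      · exact Or.inl ((s₁ b).1 hb)
      · exact Or.inr ((s₂ b).1 hb)
    · rcases hb with ⟨-, hb, -⟩ | ⟨-, hb, -⟩ <;> exact hb
    · rcases hb with ⟨-, -, hb⟩ | ⟨-, -, hb⟩ <;> exact hb
  · apply max_le <;> omega

end LongOddHole

/-! ### Arcs of an induced cycle, gaps, and parity obtained from short holes. -/

namespace LongOddHole

open SimpleGraph

variable {V : Type*} {G : SimpleGraph V}

/-- `c` winds around an induced cycle of length `n` in `G`. -/
structure CycleMap (G : SimpleGraph V) (n : ℤ) (c : ℤ → V) : Prop where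
  four_le : 4 ≤ n
  per : ∀ i, c (i + n) = c i
  ne : ∀ i j, i < j → j < i + n → c i ≠ c j
  adj : ∀ i j, i < j → j < i + n → (G.Adj (c i) (c j) ↔ j = i + 1 ∨ j + 1 = i + n)

/-- No vertex of the arc `[i, j]` is equal or adjacent to a vertex of the arc `[i', j']` in the
cycle of length `n`. -/
def Apart (n i j i' j' : ℤ) : Prop :=
  (j + 2 ≤ i' ∧ j' + 2 ≤ i + n) ∨ (j' + 2 ≤ i ∧ j + 2 ≤ i' + n)

lemma Apart.symm {n i j i' j' : ℤ} (h : Apart n i j i' j') : Apart n i' j' i j := Or.symm h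

/-- The arc `[i, j]` is the interior of an induced path between `z` and `u`; `a` is the only
neighbour of `z` in it, and `b` the only neighbour of `u`. -/
structure ArcGap (G : SimpleGraph V) (c : ℤ → V) (z u : V) (i j a b : ℤ) : Prop where
  le : i ≤ j
  ends : (a = i ∧ b = j) ∨ (a = j ∧ b = i)
  left : ∀ k, i ≤ k → k ≤ j → (G.Adj z (c k) ↔ k = a)
  right : ∀ k, i ≤ k → k ≤ j → (G.Adj u (c k) ↔ k = b)

lemma ArcGap.symm {c : ℤ → V} {z u : V} {i j a b : ℤ} (h : ArcGap G c z u i j a b) :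
    ArcGap G c u z i j b a :=
  ⟨h.le, by have := h.ends; omega, h.right, h.left⟩

lemma ArcGap.adj_left {c : ℤ → V} {z u : V} {i j a b : ℤ} (h : ArcGap G c z u i j a b) :
    G.Adj z (c a) := by
  have := h.ends; have := h.le
  exact (h.left a (by omega) (by omega)).2 rfl

lemma ArcGap.adj_right {c : ℤ → V} {z u : V} {i j a b : ℤ} (h : ArcGap G c z u i j a b) :
    G.Adj u (c b) := h.symm.adj_left

lemma exists_least {P : ℤ → Prop} {i j : ℤ} (h : ∃ k, i ≤ k ∧ k ≤ j ∧ P k) :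
    ∃ k, i ≤ k ∧ k ≤ j ∧ P k ∧ ∀ m, i ≤ m → m < k → ¬ P m := by
  obtain ⟨k, ⟨h1, h2, h3⟩, hmin⟩ := Int.exists_least_of_bdd (P := fun k => i ≤ k ∧ k ≤ j ∧ P k)
    ⟨i, fun z hz => hz.1⟩ h
  exact ⟨k, h1, h2, h3, fun m hm hmk hP => by have := hmin m ⟨hm, by omega, hP⟩; omega⟩

lemma exists_greatest {P : ℤ → Prop} {i j : ℤ} (h : ∃ k, i ≤ k ∧ k ≤ j ∧ P k) :
    ∃ k, i ≤ k ∧ k ≤ j ∧ P k ∧ ∀ m, k < m → m ≤ j → ¬ P m := by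
  obtain ⟨k, ⟨h1, h2, h3⟩, hmax⟩ := Int.exists_greatest_of_bdd (P := fun k => i ≤ k ∧ k ≤ j ∧ P k)
    ⟨j, fun z hz => hz.2.1⟩ h
  exact ⟨k, h1, h2, h3, fun m hm hmk hP => by have := hmax m ⟨by omega, hmk, hP⟩; omega⟩

/-- Take the last neighbour of `u` in `[a, b]`, then the first neighbour of `v` from there on. -/
lemma exists_arcGap_of_le {c : ℤ → V} {u v : V} {a b : ℤ} (hab : a ≤ b)
    (hu : G.Adj u (c a)) (hv : G.Adj v (c b)) :
    ∃ i j, a ≤ i ∧ j ≤ b ∧ ArcGap G c u v i j i j := by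
  obtain ⟨i, h1, h2, h3, h4⟩ := exists_greatest (P := fun k => G.Adj u (c k)) ⟨a, le_rfl, hab, hu⟩
  obtain ⟨j, h5, h6, h7, h8⟩ := exists_least (P := fun k => G.Adj v (c k)) ⟨b, h2, le_rfl, hv⟩
  refine ⟨i, j, h1, h6, h5, Or.inl ⟨rfl, rfl⟩, fun k hk hk' => ⟨fun h => ?_, fun h => h ▸ h3⟩,
    fun k hk hk' => ⟨fun h => ?_, fun h => h ▸ h7⟩⟩
  · by_contra hne
    exact h4 k (by omega) (by omega) h
  · by_contra hne
    exact h8 k (by omega) (by omega) h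

lemma exists_arcGap {c : ℤ → V} {u v : V} {a b l r : ℤ} (ha : l ≤ a) (ha' : a ≤ r) (hb : l ≤ b)
    (hb' : b ≤ r) (hu : G.Adj u (c a)) (hv : G.Adj v (c b)) :
    ∃ i j a' b', l ≤ i ∧ j ≤ r ∧ ArcGap G c u v i j a' b' := by
  rcases le_total a b with h | h
  · obtain ⟨i, j, h1, h2, h3⟩ := exists_arcGap_of_le h hu hv
    exact ⟨i, j, _, _, by omega, by omega, h3⟩
  · obtain ⟨i, j, h1, h2, h3⟩ := exists_arcGap_of_le h hv hu
    exact ⟨i, j, _, _, by omega, by omega, h3.symm⟩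

namespace CycleMap

variable {n : ℤ} {c : ℤ → V}

/-- The upper bound on `j` leaves at least one vertex of the cycle out, so the two ends are not
adjacent the other way round. -/
lemma ipath (hc : CycleMap G n c) {i j : ℤ} (hij : i ≤ j) (hj : j + 2 ≤ i + n) :
    IPath G (c '' Set.Icc i j) (c i) (c j) (j - i) := by
  induction j, hij using Int.leInduction with
  | base => simpa using IPath.single (c i)
  | succ j hij ih =>
    have h := (ih (by omega)).snoc (v := c (j + 1)) ?_ ?_ ?_
    · have e : c '' Set.Icc i (j + 1) = c '' Set.Icc i j ∪ {c (j + 1)} := by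
        ext w
        simp only [Set.mem_image, Set.mem_Icc, Set.mem_union, Set.mem_singleton_iff]
        constructor
        · rintro ⟨k, ⟨h1, h2⟩, rfl⟩
          rcases eq_or_lt_of_le h2 with rfl | h3
          · exact Or.inr rfl
          · exact Or.inl ⟨k, ⟨h1, by omega⟩, rfl⟩
        · rintro (⟨k, ⟨h1, h2⟩, rfl⟩ | rfl)
          · exact ⟨k, ⟨h1, by omega⟩, rfl⟩
          · exact ⟨j + 1, ⟨by omega, le_rfl⟩, rfl⟩
      rw [e]
      convert h using 1
      ring
    · rintro ⟨k, ⟨h1, h2⟩, h3⟩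
      exact hc.ne k (j + 1) (by omega) (by omega) h3
    · exact (hc.adj j (j + 1) (by omega) (by have := hc.four_le; omega)).2 (Or.inl rfl)
    · rintro _ ⟨k, ⟨h1, h2⟩, rfl⟩ h
      have := (hc.adj k (j + 1) (by omega) (by omega)).1 h
      congr 1
      omega

lemma apart (hc : CycleMap G n c) {i j i' j' k k' : ℤ} (h : Apart n i j i' j') (h1 : i ≤ k)
    (h2 : k ≤ j) (h3 : i' ≤ k') (h4 : k' ≤ j') : c k ≠ c k' ∧ ¬ G.Adj (c k) (c k') := by
  rcases h with h | h
  · refine ⟨hc.ne k k' (by omega) (by omega), fun h' => ?_⟩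
    have := (hc.adj k k' (by omega) (by omega)).1 h'
    omega
  · refine ⟨(hc.ne k' k (by omega) (by omega)).symm, fun h' => ?_⟩
    have := (hc.adj k' k (by omega) (by omega)).1 h'.symm
    omega

lemma gap_ipath (hc : CycleMap G n c) {z u : V} {i j a b : ℤ} (h : ArcGap G c z u i j a b)
    (hj : j + 2 ≤ i + n) : IPath G (c '' Set.Icc i j) (c a) (c b) (j - i) := by
  rcases h.ends with ⟨rfl, rfl⟩ | ⟨rfl, rfl⟩
  · exact hc.ipath h.le hj
  · exact (hc.ipath h.le hj).symm

end CycleMap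

/-- Closing an induced path of suitable length by one vertex gives a hole of even length. -/
def HolesEven (G : SimpleGraph V) (ℓ : ℕ) (n : ℤ) : Prop :=
  ∀ ⦃S : Set V⦄ ⦃a b z : V⦄ ⦃k : ℤ⦄, IPath G S a b k → z ∉ S → G.Adj z a → G.Adj z b →
    (∀ s ∈ S, G.Adj z s → s = a ∨ s = b) → 2 ≤ k → ℓ ≤ k + 2 → k + 2 < n → Even k

variable {n : ℤ} {c : ℤ → V} {ℓ : ℕ}

/-- A vertex whose only neighbours in a long arc are its ends: the arc is even. -/
lemma HolesEven.spanned (hE : HolesEven G ℓ n) (hc : CycleMap G n c) {z : V} {i j : ℤ}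
    (hz : ∀ k, z ≠ c k) (hi : G.Adj z (c i)) (hj : G.Adj z (c j))
    (hd : ∀ k, i < k → k < j → ¬ G.Adj z (c k)) (h2 : i + 2 ≤ j) (hl : ℓ ≤ j - i + 2)
    (hn : j - i + 2 < n) : Even (j - i) := by
  refine hE (hc.ipath (by omega) (by omega)) ?_ hi hj ?_ (by omega) hl hn
  · rintro ⟨k, -, h⟩
    exact hz k h.symm
  · rintro _ ⟨k, ⟨h1, h3⟩, rfl⟩ h
    rcases eq_or_lt_of_le h1 with rfl | h1
    · exact Or.inl rfl
    rcases eq_or_lt_of_le h3 with rfl | h3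
    · exact Or.inr rfl
    exact absurd h (hd k h1 h3)

/-- The parity of the hole formed by two gaps from `z` and a path `Z` joining their other ends. -/
lemma HolesEven.through (hE : HolesEven G ℓ n) (hc : CycleMap G n c) {z u v : V}
    {i j a b i' j' a' b' : ℤ} (hI : ArcGap G c z u i j a b) (hJ : ArcGap G c z v i' j' a' b')
    (hap : Apart n i j i' j') {Z : Set V} {e : ℤ} (hZ : IPath G Z u v e) (hz : ∀ k, z ≠ c k)
    (hzZ : ∀ y ∈ Z, y ≠ z ∧ ¬ G.Adj z y)
    (hZI : ∀ y ∈ Z, ∀ k, i ≤ k → k ≤ j → y ≠ c k ∧ (G.Adj y (c k) → y = u ∧ k = b))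
    (hZJ : ∀ y ∈ Z, ∀ k, i' ≤ k → k ≤ j' → y ≠ c k ∧ (G.Adj y (c k) → y = v ∧ k = b'))
    (hl : ℓ ≤ (j - i) + (j' - i') + e + 4) (hn : (j - i) + (j' - i') + e + 4 < n) :
    Even ((j - i) + (j' - i') + e) := by
  have le := hI.le
  have le' := hJ.le
  have e0 := hZ.nonneg
  have p := ((hc.gap_ipath hI (by unfold Apart at hap; omega)).join hZ hI.adj_right.symm ?_).join
    (hc.gap_ipath hJ (by unfold Apart at hap; omega)).symm hJ.adj_right ?_
  · have := hE (z := z) p ?_ hI.adj_left hJ.adj_left ?_ (by omega) (by omega) (by omega)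
    · rw [Int.even_iff] at this ⊢
      omega
    · rintro ((⟨k, -, h⟩ | h) | ⟨k, -, h⟩)
      · exact hz k h.symm
      · exact (hzZ z h).1 rfl
      · exact hz k h.symm
    · rintro _ ((⟨k, ⟨h1, h2⟩, rfl⟩ | h) | ⟨k, ⟨h1, h2⟩, rfl⟩) h'
      · exact Or.inl (congrArg c ((hI.left k h1 h2).1 h'))
      · exact absurd h' (hzZ _ h).2
      · exact Or.inr (congrArg c ((hJ.left k h1 h2).1 h'))
  · rintro _ ⟨k, ⟨h1, h2⟩, rfl⟩ y hy
    have := hZI y hy k h1 h2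
    exact ⟨this.1.symm, fun h => by obtain ⟨rfl, rfl⟩ := this.2 h.symm; exact ⟨rfl, rfl⟩⟩
  · rintro y (⟨k, ⟨h1, h2⟩, rfl⟩ | hy) _ ⟨k', ⟨h3, h4⟩, rfl⟩
    · have := hc.apart hap h1 h2 h3 h4
      exact ⟨this.1, fun h => absurd h this.2⟩
    · have := hZJ y hy k' h3 h4
      exact ⟨this.1, fun h => by obtain ⟨rfl, rfl⟩ := this.2 h; exact ⟨rfl, rfl⟩⟩

/-- Two gaps between the same nonadjacent vertices that are far apart have the same parity. -/
lemma HolesEven.two_gaps (hE : HolesEven G ℓ n) (hc : CycleMap G n c) {z u : V}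
    {i j a b i' j' a' b' : ℤ} (hI : ArcGap G c z u i j a b) (hJ : ArcGap G c z u i' j' a' b')
    (hap : Apart n i j i' j') (hz : ∀ k, z ≠ c k) (hu : ∀ k, u ≠ c k) (hzu : u ≠ z)
    (hadj : ¬ G.Adj z u) (hl : ℓ ≤ (j - i) + (j' - i') + 4) (hn : (j - i) + (j' - i') + 4 < n) :
    Even ((j - i) + (j' - i')) := by
  have := hE.through hc hI hJ hap (IPath.single u) hz (by rintro y rfl; exact ⟨hzu, hadj⟩)
    (by rintro y rfl k h1 h2; exact ⟨hu k, fun h => ⟨rfl, (hI.right k h1 h2).1 h⟩⟩)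
    (by rintro y rfl k h1 h2; exact ⟨hu k, fun h => ⟨rfl, (hJ.right k h1 h2).1 h⟩⟩)
    (by omega) (by omega)
  simpa using this

lemma IPath.pair {u v : V} (h : G.Adj u v) : IPath G {u, v} u v 1 := by
  have := (IPath.single (G := G) u).snoc (v := v) (by simpa using h.ne') h (by simp)
  simpa [Set.insert_def, Set.union_def] using this

/-- The hole formed by two gaps from `z` to adjacent vertices `u`, `v`. -/
lemma HolesEven.adjacent_gaps (hE : HolesEven G ℓ n) (hc : CycleMap G n c) {z u v : V}
    {i j a b i' j' a' b' : ℤ} (hI : ArcGap G c z u i j a b) (hJ : ArcGap G c z v i' j' a' b')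
    (hap : Apart n i j i' j') (hz : ∀ k, z ≠ c k) (hu : ∀ k, u ≠ c k) (hv : ∀ k, v ≠ c k)
    (hzu : u ≠ z) (hzv : v ≠ z) (hadju : ¬ G.Adj z u) (hadjv : ¬ G.Adj z v) (huv : G.Adj u v)
    (huJ : ∀ k, i' ≤ k → k ≤ j' → ¬ G.Adj u (c k)) (hvI : ∀ k, i ≤ k → k ≤ j → ¬ G.Adj v (c k))
    (hl : ℓ ≤ (j - i) + (j' - i') + 5) (hn : (j - i) + (j' - i') + 5 < n) :
    Even ((j - i) + (j' - i') + 1) := by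
  refine hE.through hc hI hJ hap (IPath.pair huv) hz ?_ ?_ ?_ (by omega) (by omega)
  · rintro y (rfl | rfl)
    · exact ⟨hzu, hadju⟩
    · exact ⟨hzv, hadjv⟩
  · rintro y (rfl | rfl) k h1 h2
    · exact ⟨hu k, fun h => ⟨rfl, (hI.right k h1 h2).1 h⟩⟩
    · exact ⟨hv k, fun h => absurd h (hvI k h1 h2)⟩
  · rintro y (rfl | rfl) k h1 h2
    · exact ⟨hu k, fun h => absurd h (huJ k h1 h2)⟩
    · exact ⟨hv k, fun h => ⟨rfl, (hJ.right k h1 h2).1 h⟩⟩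

end LongOddHole

/-! ### The arc of the base, its members, and detours that produce jewels and pyramids. -/

namespace LongOddHole

open SimpleGraph

variable {V : Type*} {G : SimpleGraph V}

/-- The cycle `c` of length `n` in a graph without the forbidden configurations, and a vertex `x`
whose only neighbours in the long arc `[0, δ]` are its ends. -/
structure Setup (G : SimpleGraph V) (ℓ : ℕ) (n δ : ℤ) (c : ℤ → V) (x : V) : Prop where
  cyc : CycleMap G n c
  pyr : ¬ HasLongPyramid G ℓ
  jew : ¬ HasLongJewel G ℓ (ℓ + 2)
  even : HolesEven G ℓ n
  off : ∀ k, x ≠ c k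
  adj_zero : G.Adj x (c 0)
  adj_end : G.Adj x (c δ)
  nadj : ∀ k, 0 < k → k < δ → ¬ G.Adj x (c k)
  five_le : 5 ≤ ℓ
  le_delta : 2 * ℓ ≤ δ
  delta_le : δ + 3 ≤ n

/-- A vertex off the cycle, nonadjacent to `x`, with neighbours in the arc `[0, δ]` but none close
to its ends. -/
structure Member (G : SimpleGraph V) (ℓ : ℕ) (n δ : ℤ) (c : ℤ → V) (x u : V) : Prop where
  off : ∀ k, u ≠ c k
  ne : u ≠ x
  nadj : ¬ G.Adj x u
  far : ∀ k, 0 ≤ k → k ≤ n → G.Adj u (c k) → ℓ ≤ k ∧ k + ℓ ≤ n ∧ (k + ℓ ≤ δ ∨ δ + ℓ ≤ k)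
  meets : ∃ k, 0 ≤ k ∧ k ≤ δ ∧ G.Adj u (c k)

/-- `f` is the position of the first neighbour of `u` in the arc `[0, δ]`. -/
structure IsFirst (G : SimpleGraph V) (δ : ℤ) (c : ℤ → V) (u : V) (f : ℤ) : Prop where
  nonneg : 0 ≤ f
  le : f ≤ δ
  adj : G.Adj u (c f)
  min : ∀ k, 0 ≤ k → k < f → ¬ G.Adj u (c k)

/-- The arcs `[i, j]` and `[i', j']` are consecutive, and `a`, `a'` are the adjacent ends. -/
def Touch (i j a i' j' a' : ℤ) : Prop :=
  (j + 1 = i' ∧ a = j ∧ a' = i') ∨ (j' + 1 = i ∧ a = i ∧ a' = j')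

lemma Touch.symm {i j a i' j' a' : ℤ} (h : Touch i j a i' j' a') : Touch i' j' a' i j a := by
  unfold Touch at *
  omega

/-- The bounds `w` and `w'` exclude a second contact of the two arcs the other way round the cycle.
-/
lemma CycleMap.touch {n : ℤ} {c : ℤ → V} (hc : CycleMap G n c) {i j a i' j' a' k k' : ℤ}
    (h : Touch i j a i' j' a') (w : j' + 2 ≤ i + n) (w' : j + 2 ≤ i' + n) (h1 : i ≤ k)
    (h2 : k ≤ j) (h3 : i' ≤ k') (h4 : k' ≤ j') :
    c k ≠ c k' ∧ (G.Adj (c k) (c k') → c k = c a ∧ c k' = c a') := by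
  rcases h with ⟨h, rfl, rfl⟩ | ⟨h, rfl, rfl⟩
  · refine ⟨hc.ne k k' (by omega) (by omega), fun h' => ?_⟩
    have := (hc.adj k k' (by omega) (by omega)).1 h'
    constructor <;> congr 1 <;> omega
  · refine ⟨(hc.ne k' k (by omega) (by omega)).symm, fun h' => ?_⟩
    have := (hc.adj k' k (by omega) (by omega)).1 h'.symm
    constructor <;> congr 1 <;> omega

variable {ℓ : ℕ} {n δ : ℤ} {c : ℤ → V} {x u v : V}

lemma Member.exists_isFirst (h : Member G ℓ n δ c x u) : ∃ f, IsFirst G δ c u f := by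
  obtain ⟨f, h1, h2, h3, h4⟩ := exists_least h.meets
  exact ⟨f, h1, h2, h3, h4⟩

namespace CycleMap

/-- The induced path from `u` to `z` through a gap. -/
lemma full_ipath (hc : CycleMap G n c) {z u : V} {i j a b : ℤ} (h : ArcGap G c z u i j a b)
    (hj : j + 2 ≤ i + n) (hz : ∀ k, z ≠ c k) (hu : ∀ k, u ≠ c k) (hzu : u ≠ z)
    (hadj : ¬ G.Adj z u) : IPath G ((c '' Set.Icc i j ∪ {u}) ∪ {z}) u z (j - i + 2) := by
  have h1 := ((hc.gap_ipath h hj).snoc (v := u) ?_ h.adj_right.symm ?_).symm.snoc (v := z) ?_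
    h.adj_left.symm ?_
  · convert h1 using 1
    ring
  · rintro ⟨k, -, h'⟩
    exact hu k h'.symm
  · rintro _ ⟨k, ⟨h1, h2⟩, rfl⟩ h'
    rw [(h.right k h1 h2).1 h'.symm]
  · rintro (⟨k, -, h'⟩ | h')
    · exact hz k h'.symm
    · exact hzu h'.symm
  · rintro _ (⟨k, ⟨h1, h2⟩, rfl⟩ | rfl) h'
    · rw [(h.left k h1 h2).1 h'.symm]
    · exact absurd h'.symm hadj

/-- The induced path from `u` to the last vertex of a gap before `z`. -/
lemma half_ipath (hc : CycleMap G n c) {z u : V} {i j a b : ℤ} (h : ArcGap G c z u i j a b)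
    (hj : j + 2 ≤ i + n) (hu : ∀ k, u ≠ c k) :
    IPath G (c '' Set.Icc i j ∪ {u}) u (c a) (j - i + 1) := by
  refine ((hc.gap_ipath h hj).snoc (v := u) ?_ h.adj_right.symm ?_).symm
  · rintro ⟨k, -, h'⟩
    exact hu k h'.symm
  · rintro _ ⟨k, ⟨h1, h2⟩, rfl⟩ h'
    rw [(h.right k h1 h2).1 h'.symm]

end CycleMap

namespace Setup

lemma first_bounds (hS : Setup G ℓ n δ c x) (hu : Member G ℓ n δ c x u) {f : ℤ}
    (hf : IsFirst G δ c u f) : ℓ ≤ f ∧ f + ℓ ≤ δ := by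
  have := hS.delta_le
  have := hS.five_le
  have h := hu.far f hf.nonneg (by have := hf.le; omega) hf.adj
  have := hf.le
  omega

lemma first_gap (hS : Setup G ℓ n δ c x) (hu : Member G ℓ n δ c x u) {f : ℤ}
    (hf : IsFirst G δ c u f) : ArcGap G c x u 0 f 0 f := by
  have hb := hS.first_bounds hu hf
  have := hS.five_le
  refine ⟨by omega, Or.inl ⟨rfl, rfl⟩, fun k h1 h2 => ⟨fun h => ?_, fun h => h ▸ hS.adj_zero⟩,
    fun k h1 h2 => ⟨fun h => ?_, fun h => h ▸ hf.adj⟩⟩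
  · by_contra hne
    exact hS.nadj k (by omega) (by omega) h
  · by_contra hne
    exact hf.min k h1 (by omega) h

/-- The induced path from `u` to `x` through the first arc. -/
lemma stem (hS : Setup G ℓ n δ c x) (hu : Member G ℓ n δ c x u) {f : ℤ}
    (hf : IsFirst G δ c u f) : IPath G ((c '' Set.Icc 0 f ∪ {u}) ∪ {x}) u x (f + 2) := by
  have hb := hS.first_bounds hu hf
  have := hS.delta_le
  have := hS.five_le
  have h := hS.cyc.full_ipath (hS.first_gap hu hf) (by omega) hS.off hu.off hu.ne hu.nadj
  simpa using h

section Detour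

variable {i j a b i' j' a' b' f e : ℤ} {Z : Set V}

/-- A path from `u` to `v` inside the arc `[f + 2, δ - 1]`. -/
structure IsDetour (G : SimpleGraph V) (δ f : ℤ) (c : ℤ → V) (u v : V) (Z : Set V) (e : ℤ) :
    Prop where
  path : IPath G Z u v e
  mem : ∀ y ∈ Z, y = u ∨ y = v ∨ ∃ k, f + 2 ≤ k ∧ k < δ ∧ c k = y

/-- This path runs along the detour to `v` and then along the gap of `v` to the last vertex before
`x`. It is a branch of the pyramid and, extended by `x`, a path of the jewel. -/
lemma tail_ipath (hS : Setup G ℓ n δ c x) (hu : Member G ℓ n δ c x u)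
    (hv : Member G ℓ n δ c x v) (hJ : ArcGap G c x v i' j' a' b') (hi' : δ + 2 ≤ i')
    (hj' : j' + 2 ≤ n) (huJ : ∀ k, i' ≤ k → k ≤ j' → ¬ G.Adj u (c k))
    (hf : IsFirst G δ c u f) (hZ : IsDetour G δ f c u v Z e) :
    IPath G (Z ∪ c '' Set.Icc i' j') u (c a') (e + (j' - i') + 1) := by
  have := hS.delta_le
  have := hS.le_delta
  have := hf.nonneg
  refine hZ.path.join (hS.cyc.gap_ipath hJ (by omega)).symm hJ.adj_right ?_
  rintro y hy _ ⟨k, ⟨h1, h2⟩, rfl⟩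
  rcases hZ.mem y hy with rfl | rfl | ⟨k', h3, h4, rfl⟩
  · exact ⟨hu.off k, fun h => absurd h (huJ k h1 h2)⟩
  · exact ⟨hv.off k, fun h => ⟨rfl, by rw [(hJ.right k h1 h2).1 h]⟩⟩
  · have := hS.cyc.apart (n := n) (i := f + 2) (j := δ - 1) (i' := i') (j' := j')
      (Or.inl ⟨by omega, by omega⟩) h3 (by omega) h1 h2
    exact ⟨this.1, fun h => absurd h this.2⟩

/-- A detour of odd length between two members with gaps of the same parity that are apart gives an
odd hole or a jewel. -/
lemma no_odd_detour (hS : Setup G ℓ n δ c x) (hu : Member G ℓ n δ c x u)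
    (hv : Member G ℓ n δ c x v) (huv : u ≠ v) (hI : ArcGap G c x u i j a b)
    (hJ : ArcGap G c x v i' j' a' b') (hap : Apart n i j i' j') (hi : δ + 2 ≤ i) (hj : j + 2 ≤ n)
    (hi' : δ + 2 ≤ i') (hj' : j' + 2 ≤ n) (huJ : ∀ k, i' ≤ k → k ≤ j' → ¬ G.Adj u (c k))
    (hvI : ∀ k, i ≤ k → k ≤ j → ¬ G.Adj v (c k)) (hpar : Even (j - i) ↔ Even (j' - i'))
    (hf : IsFirst G δ c u f) (hvf : ∀ k, 0 ≤ k → k ≤ f → ¬ G.Adj v (c k))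
    (hZ : IsDetour G δ f c u v Z e) (heu : e ≤ δ - f) (he : Odd e) : False := by
  have hδ := hS.delta_le
  have hδ' := hS.le_delta
  have hℓ := hS.five_le
  have hb := hS.first_bounds hu hf
  have hIle := hI.le
  have he0 := hZ.path.nonneg
  have hJle := hJ.le
  have hapD : ∀ {k k'}, f + 2 ≤ k → k < δ → δ + 2 ≤ k' → k' + 2 ≤ n →
      c k ≠ c k' ∧ ¬ G.Adj (c k) (c k') := fun {k k'} h1 h2 h3 h4 =>
    hS.cyc.apart (n := n) (i := f + 2) (j := δ - 1) (i' := δ + 2) (j' := n - 2)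
      (Or.inl ⟨by omega, by omega⟩) h1 (by omega) h3 (by omega)
  -- The hole through `x`, the two gaps and the detour is odd. It is shorter than the cycle because
  -- `e ≤ δ - f` and the gaps are apart outside `[0, δ]`; so it cannot be long.
  have hshort : (j - i) + (j' - i') + e + 4 < ℓ := by
    by_contra hlong
    have h1 := hS.even.through hS.cyc hI hJ hap hZ.path hS.off ?_ ?_ ?_ (by omega)
      (by unfold Apart at hap; omega)
    · rw [Int.even_iff, Int.even_iff] at hpar
      rw [Int.even_iff] at h1
      rw [Int.odd_iff] at he
      omega
    · intro y hy
      rcases hZ.mem y hy with rfl | rfl | ⟨k', h3, h4, rfl⟩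
      · exact ⟨hu.ne, hu.nadj⟩
      · exact ⟨hv.ne, hv.nadj⟩
      · exact ⟨(hS.off k').symm, hS.nadj k' (by omega) (by omega)⟩
    · intro y hy k h1 h2
      rcases hZ.mem y hy with rfl | rfl | ⟨k', h3, h4, rfl⟩
      · exact ⟨hu.off k, fun h => ⟨rfl, (hI.right k h1 h2).1 h⟩⟩
      · exact ⟨hv.off k, fun h => absurd h (hvI k h1 h2)⟩
      · have := hapD h3 h4 (k' := k) (by omega) (by omega)
        exact ⟨this.1, fun h => absurd h this.2⟩
    · intro y hy k h1 h2
      rcases hZ.mem y hy with rfl | rfl | ⟨k', h3, h4, rfl⟩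
      · exact ⟨hu.off k, fun h => absurd h (huJ k h1 h2)⟩
      · exact ⟨hv.off k, fun h => ⟨rfl, (hJ.right k h1 h2).1 h⟩⟩
      · have := hapD h3 h4 (k' := k) (by omega) (by omega)
        exact ⟨this.1, fun h => absurd h this.2⟩
  -- A jewel between `u` and `x`: the gap of `u` and the detour followed by the gap of `v` have
  -- different parity and are short by `hshort`, while the stem through `[0, f]` is long.
  have p₂ := (hS.tail_ipath hu hv hJ hi' hj' huJ hf hZ).snoc (v := x) ?_ hJ.adj_left.symm ?_
  · refine not_hasLongJewel_paths hS.jew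
      (hS.cyc.full_ipath hI (by omega) hS.off hu.off hu.ne hu.nadj) p₂ (hS.stem hu hf) ?_
      (by omega) ?_ (by push_cast; omega) (by push_cast; omega)
    · rw [Int.even_iff, Int.even_iff] at hpar ⊢
      rw [Int.odd_iff] at he
      omega
    · rintro _ ((⟨k, ⟨h1, h2⟩, rfl⟩ | h) | h) hne hne' t ht hne2 hne2'
      · have hout : ∀ {k'}, δ + 2 ≤ k' → k' + 2 ≤ n → c k ≠ c k' ∧ ¬ G.Adj (c k) (c k') :=
          fun {k'} h3 h4 => hS.cyc.apart (n := n) (i := 0) (j := f) (i' := δ + 2) (j' := n - 2)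
            (Or.inl ⟨by omega, by omega⟩) h1 h2 h3 (by omega)
        rcases ht with ((⟨k', ⟨h3, h4⟩, rfl⟩ | ht) | ht) | ((ht | ⟨k', ⟨h3, h4⟩, rfl⟩) | ht)
        · exact hout (by omega) (by omega)
        · exact absurd ht hne2
        · exact absurd ht hne2'
        · rcases hZ.mem t ht with rfl | rfl | ⟨k', h3, h4, rfl⟩
          · exact absurd rfl hne2
          · exact ⟨(hv.off k).symm, fun h => hvf k h1 h2 h.symm⟩
          · exact hS.cyc.apart (n := n) (i := 0) (j := f) (i' := f + 2) (j' := δ)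
              (Or.inl ⟨by omega, by omega⟩) h1 h2 h3 (by omega)
        · exact hout (by omega) (by omega)
        · exact absurd ht hne2'
      · exact absurd h hne
      · exact absurd h hne'
  · rintro (h | ⟨k, -, h⟩)
    · rcases hZ.mem x h with h | h | ⟨k', -, -, h⟩
      · exact hu.ne h.symm
      · exact hv.ne h.symm
      · exact hS.off k' h.symm
    · exact hS.off k h.symm
  · rintro y (hy | ⟨k, ⟨h1, h2⟩, rfl⟩) h
    · rcases hZ.mem y hy with rfl | rfl | ⟨k', h3, h4, rfl⟩
      · exact absurd h.symm hu.nadj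
      · exact absurd h.symm hv.nadj
      · exact absurd h.symm (hS.nadj k' (by omega) (by omega))
    · rw [(hJ.left k h1 h2).1 h.symm]

/-- A detour between two members whose gaps are consecutive gives a pyramid. -/
lemma no_touching_detour (hS : Setup G ℓ n δ c x) (hu : Member G ℓ n δ c x u)
    (hv : Member G ℓ n δ c x v) (hI : ArcGap G c x u i j a b)
    (hJ : ArcGap G c x v i' j' a' b') (ht : Touch i j a i' j' a') (hi : δ + 2 ≤ i)
    (hj : j + 2 ≤ n) (hi' : δ + 2 ≤ i') (hj' : j' + 2 ≤ n)
    (huJ : ∀ k, i' ≤ k → k ≤ j' → ¬ G.Adj u (c k))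
    (hvI : ∀ k, i ≤ k → k ≤ j → ¬ G.Adj v (c k)) (hlong : ℓ ≤ j - i + 1 ∨ ℓ ≤ j' - i' + 1)
    (hf : IsFirst G δ c u f) (hvf : ∀ k, 0 ≤ k → k ≤ f → ¬ G.Adj v (c k))
    (hZ : IsDetour G δ f c u v Z e) : False := by
  have hδ := hS.delta_le
  have hδ' := hS.le_delta
  have hℓ := hS.five_le
  have hb := hS.first_bounds hu hf
  have hIle := hI.le
  have hJle := hJ.le
  have he := hZ.path.nonneg
  -- The pyramid has apex `u` and base `x`, `c a`, `c a'`. The stem is long since `ℓ ≤ f`, so one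
  -- further long branch suffices.
  have p₀ := hS.stem hu hf
  have p₁ := hS.cyc.half_ipath hI (by omega) hu.off
  have p₂ := hS.tail_ipath hu hv hJ hi' hj' huJ hf hZ
  have hout : ∀ {k k'}, 0 ≤ k → k < δ → δ + 2 ≤ k' → k' + 2 ≤ n →
      c k ≠ c k' ∧ ¬ G.Adj (c k) (c k') := fun {k k'} h1 h2 h3 h4 =>
    hS.cyc.apart (n := n) (i := 0) (j := δ - 1) (i' := δ + 2) (j' := n - 2)
      (Or.inl ⟨by omega, by omega⟩) h1 (by omega) h3 (by omega)
  have hadj : G.Adj (c a) (c a') := by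
    rcases ht with ⟨h, rfl, rfl⟩ | ⟨h, rfl, rfl⟩
    · exact (hS.cyc.adj _ _ (by omega) (by omega)).2 (Or.inl h.symm)
    · exact ((hS.cyc.adj _ _ (by omega) (by omega)).2 (Or.inl h.symm)).symm
  have d₀₁ : ∀ s ∈ (c '' Set.Icc 0 f ∪ {u}) ∪ {x}, ∀ t ∈ c '' Set.Icc i j ∪ {u}, s ≠ u → t ≠ u →
      s ≠ t ∧ (G.Adj s t → s = x ∧ t = c a) := by
    rintro _ ((⟨k, ⟨h1, h2⟩, rfl⟩ | h) | rfl) _ (⟨k', ⟨h3, h4⟩, rfl⟩ | h') hne hne'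
    all_goals try exact absurd h hne
    all_goals try exact absurd h' hne'
    · have := hout h1 (by omega) (k' := k') (by omega) (by omega)
      exact ⟨this.1, fun h => absurd h this.2⟩
    · exact ⟨hS.off k', fun h => ⟨rfl, by rw [(hI.left k' h3 h4).1 h]⟩⟩
  have d₀₂ : ∀ s ∈ (c '' Set.Icc 0 f ∪ {u}) ∪ {x}, ∀ t ∈ Z ∪ c '' Set.Icc i' j', s ≠ u → t ≠ u →
      s ≠ t ∧ (G.Adj s t → s = x ∧ t = c a') := by
    rintro s hs t (ht | ⟨k', ⟨h3, h4⟩, rfl⟩) hne hne'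
    · rcases hZ.mem t ht with rfl | rfl | ⟨k', h3, h4, rfl⟩
      · exact absurd rfl hne'
      · rcases hs with (⟨k, ⟨h1, h2⟩, rfl⟩ | h) | rfl
        · exact ⟨(hv.off k).symm, fun h => absurd h.symm (hvf k h1 h2)⟩
        · exact absurd h hne
        · exact ⟨hv.ne.symm, fun h => absurd h hv.nadj⟩
      · rcases hs with (⟨k, ⟨h1, h2⟩, rfl⟩ | h) | rfl
        · have := hS.cyc.apart (n := n) (i := 0) (j := f) (i' := f + 2) (j' := δ)
              (Or.inl ⟨by omega, by omega⟩) h1 h2 h3 (by omega)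
          exact ⟨this.1, fun h => absurd h this.2⟩
        · exact absurd h hne
        · exact ⟨hS.off k', fun h => absurd h (hS.nadj k' (by omega) (by omega))⟩
    · rcases hs with (⟨k, ⟨h1, h2⟩, rfl⟩ | h) | rfl
      · have := hout h1 (by omega) (k' := k') (by omega) (by omega)
        exact ⟨this.1, fun h => absurd h this.2⟩
      · exact absurd h hne
      · exact ⟨hS.off k', fun h => ⟨rfl, by rw [(hJ.left k' h3 h4).1 h]⟩⟩
  have d₁₂ : ∀ s ∈ c '' Set.Icc i j ∪ {u}, ∀ t ∈ Z ∪ c '' Set.Icc i' j', s ≠ u → t ≠ u →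
      s ≠ t ∧ (G.Adj s t → s = c a ∧ t = c a') := by
    rintro _ (⟨k, ⟨h1, h2⟩, rfl⟩ | h) t (hy | ⟨k', ⟨h3, h4⟩, rfl⟩) hne hne'
    all_goals try exact absurd h hne
    · rcases hZ.mem t hy with rfl | rfl | ⟨k', h3, h4, rfl⟩
      · exact absurd rfl hne'
      · exact ⟨(hv.off k).symm, fun h => absurd h.symm (hvI k h1 h2)⟩
      · have := hout (k := k') (k' := k) (by omega) (by omega) (by omega) (by omega)
        exact ⟨this.1.symm, fun h => absurd h.symm this.2⟩
    · exact hS.cyc.touch ht (by omega) (by omega) h1 h2 h3 h4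
  rcases hlong with hlong | hlong
  · exact not_hasLongPyramid_paths hS.pyr p₀ p₁ p₂ hu.ne.symm (hu.off a).symm (hu.off a').symm
      hI.adj_left hJ.adj_left hadj (by omega) (by omega) d₀₁ d₀₂ d₁₂
  · refine not_hasLongPyramid_paths hS.pyr p₀ p₂ p₁ hu.ne.symm (hu.off a').symm (hu.off a).symm
      hJ.adj_left hI.adj_left hadj.symm (by omega) (by omega) d₀₂ d₀₁ ?_
    intro s hs t ht h1 h2
    have := d₁₂ t ht s hs h2 h1
    exact ⟨this.1.symm, fun h => (this.2 h.symm).symm⟩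

end Detour

end Setup

end LongOddHole

/-! ### Pairs of members with equal parity: even gaps and close first neighbours. -/

namespace LongOddHole

open SimpleGraph

variable {V : Type*} {G : SimpleGraph V}
variable {ℓ : ℕ} {n δ : ℤ} {c : ℤ → V} {x u v w : V}

/-- A set of members whose gaps to `x` all have the same parity. -/
structure Family (G : SimpleGraph V) (ℓ : ℕ) (n δ : ℤ) (c : ℤ → V) (x : V) (M : Set V) (p : Prop) :
    Prop where
  member : ∀ u ∈ M, Member G ℓ n δ c x u
  spread : ∀ u ∈ M, ∀ f, IsFirst G δ c u f → (∀ k, 0 ≤ k → k ≤ δ → G.Adj u (c k) → k = f) ∨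
    ∃ k, f + 2 ≤ k ∧ k ≤ δ ∧ G.Adj u (c k)
  par_first : ∀ u ∈ M, ∀ f, IsFirst G δ c u f → (Even f ↔ p)
  par_gap : ∀ u ∈ M, ∀ i j a b, ArcGap G c x u i j a b → δ + 2 ≤ i → j + 2 ≤ n → (Even (j - i) ↔ p)

variable {M : Set V} {p : Prop} {i j a b i' j' a' b' f g : ℤ}

lemma IsFirst.unique (hf : IsFirst G δ c u f) (hg : IsFirst G δ c u g) : f = g := by
  by_contra hne
  rcases lt_or_gt_of_ne hne with h | h
  · exact hg.min f hf.nonneg h hf.adj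
  · exact hf.min g hg.nonneg h hg.adj

namespace Setup

lemma edge_detour (huv : G.Adj u v) : IsDetour G δ f c u v {u, v} 1 :=
  ⟨IPath.pair huv, by rintro y (rfl | rfl) <;> simp⟩

/-- Both vertices have neighbours in `[f + 2, δ - 1]`, so a gap lies there. Starting at `f + 2`
keeps it away from the stem `[0, f]`, and stopping before `δ` keeps it away from the neighbours of
`x`. -/
lemma exists_detour (hS : Setup G ℓ n δ c x) (hu : Member G ℓ n δ c x u)
    (hv : Member G ℓ n δ c x v) (huv : ¬ G.Adj u v) (hf : IsFirst G δ c u f)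
    (hg : IsFirst G δ c v g) (hfg : f + 2 ≤ g) (hk : ∃ k, f + 2 ≤ k ∧ k ≤ δ ∧ G.Adj u (c k)) :
    ∃ i j a b, f + 2 ≤ i ∧ j < δ ∧ ArcGap G c u v i j a b ∧
      ∃ Z, IsDetour G δ f c u v Z (j - i + 2) := by
  have hδ := hS.delta_le
  have hδ' := hS.le_delta
  have hℓ := hS.five_le
  have hbu := hS.first_bounds hu hf
  have hbv := hS.first_bounds hv hg
  obtain ⟨k, h1, h2, h3⟩ := hk
  have hk' := hu.far k (by omega) (by omega) h3
  obtain ⟨i, j, a, b, h4, h5, h6⟩ := exists_arcGap (l := f + 2) (r := δ - 1) h1 (by omega) hfg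
    (by omega) h3 hg.adj
  refine ⟨i, j, a, b, h4, by omega, h6, _, hS.cyc.full_ipath h6.symm (by omega) hv.off hu.off ?_
    (fun h => huv h.symm), ?_⟩
  · rintro rfl
    have := hf.unique hg
    omega
  · rintro y ((⟨k, ⟨h7, h8⟩, rfl⟩ | hy) | hy)
    · exact Or.inr (Or.inr ⟨k, by omega, by omega, rfl⟩)
    · exact Or.inl hy
    · exact Or.inr (Or.inl hy)

/-- The edge between `u` and `v` is itself a detour of odd length 1, from whichever vertex has the
earlier first neighbour. -/
lemma eq_first_of_adj (hS : Setup G ℓ n δ c x) (hM : Family G ℓ n δ c x M p) (hu : u ∈ M)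
    (hv : v ∈ M) (huv : G.Adj u v) (hI : ArcGap G c x u i j a b)
    (hJ : ArcGap G c x v i' j' a' b') (hap : Apart n i j i' j') (hi : δ + 2 ≤ i) (hj : j + 2 ≤ n)
    (hi' : δ + 2 ≤ i') (hj' : j' + 2 ≤ n) (huJ : ∀ k, i' ≤ k → k ≤ j' → ¬ G.Adj u (c k))
    (hvI : ∀ k, i ≤ k → k ≤ j → ¬ G.Adj v (c k)) (hf : IsFirst G δ c u f)
    (hg : IsFirst G δ c v g) : f = g := by
  have mu := hM.member u hu
  have mv := hM.member v hv
  have hℓ := hS.five_le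
  have hpu := hM.par_gap u hu _ _ _ _ hI hi hj
  have hpv := hM.par_gap v hv _ _ _ _ hJ hi' hj'
  have hb := hS.first_bounds mu hf
  have hb' := hS.first_bounds mv hg
  by_contra hne
  rcases lt_or_gt_of_ne hne with h | h
  · exact hS.no_odd_detour mu mv huv.ne hI hJ hap hi hj hi' hj' huJ hvI (hpu.trans hpv.symm) hf
      (fun k h1 h2 => hg.min k h1 (by omega)) (edge_detour huv) (by omega) odd_one
  · exact hS.no_odd_detour mv mu huv.ne' hJ hI hap.symm hi' hj' hi hj hvI huJ
      (hpv.trans hpu.symm) hg (fun k h1 h2 => hf.min k h1 (by omega)) (edge_detour huv.symm)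
      (by omega) odd_one

lemma exists_even_gap_aux (hS : Setup G ℓ n δ c x) (hM : Family G ℓ n δ c x M p) (hu : u ∈ M)
    (hv : v ∈ M) (huv : ¬ G.Adj u v) (hI : ArcGap G c x u i j a b)
    (hJ : ArcGap G c x v i' j' a' b') (hap : Apart n i j i' j') (hi : δ + 2 ≤ i) (hj : j + 2 ≤ n)
    (hi' : δ + 2 ≤ i') (hj' : j' + 2 ≤ n) (huJ : ∀ k, i' ≤ k → k ≤ j' → ¬ G.Adj u (c k))
    (hvI : ∀ k, i ≤ k → k ≤ j → ¬ G.Adj v (c k)) (hf : IsFirst G δ c u f)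
    (hg : IsFirst G δ c v g) (hfg : f + 2 ≤ g) :
    ∃ k l d e, 0 < k ∧ l < δ ∧ ArcGap G c u v k l d e ∧ Even (l - k) := by
  have mu := hM.member u hu
  have mv := hM.member v hv
  have hℓ := hS.five_le
  have hpu := hM.par_gap u hu _ _ _ _ hI hi hj
  have hpv := hM.par_gap v hv _ _ _ _ hJ hi' hj'
  have hb := hS.first_bounds mu hf
  have hb' := hS.first_bounds mv hg
  rcases hM.spread u hu f hf with h | h
  -- With only one neighbour of `u` in `[0, δ]`, the arc `[f, g]` is a gap; it is even because `f`
  -- and `g` both have the common parity `p`.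
  · refine ⟨f, g, f, g, by omega, by omega, ⟨by omega, Or.inl ⟨rfl, rfl⟩, ?_, ?_⟩, ?_⟩
    · exact fun k h1 h2 => ⟨h k (by omega) (by omega), fun h => h ▸ hf.adj⟩
    · intro k h1 h2
      refine ⟨fun h3 => ?_, fun h => h ▸ hg.adj⟩
      by_contra hne
      exact hg.min k (by omega) (by omega) h3
    · have h1 := (hM.par_first u hu f hf).trans (hM.par_first v hv g hg).symm
      rw [Int.even_sub, h1]
  -- The detour is longer by 2 than its gap, so an odd gap would give an odd detour.
  · obtain ⟨k, l, d, e, h1, h2, h3, Z, hZ⟩ := hS.exists_detour mu mv huv hf hg hfg h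
    refine ⟨k, l, d, e, by omega, h2, h3, ?_⟩
    by_contra hodd
    refine hS.no_odd_detour mu mv ?_ hI hJ hap hi hj hi' hj' huJ hvI (hpu.trans hpv.symm) hf
      (fun k h1 h2 => hg.min k h1 (by omega)) hZ (by omega) ?_
    · rintro rfl
      have := hf.unique hg
      omega
    · rw [Int.not_even_iff] at hodd
      rw [Int.odd_iff]
      omega

/-- Two members with gaps to `x` that are apart, and with first neighbours not close to each other,
are nonadjacent and have an even gap inside `[0, δ]`. -/
lemma exists_even_gap (hS : Setup G ℓ n δ c x) (hM : Family G ℓ n δ c x M p) (hu : u ∈ M)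
    (hv : v ∈ M) (hI : ArcGap G c x u i j a b)
    (hJ : ArcGap G c x v i' j' a' b') (hap : Apart n i j i' j') (hi : δ + 2 ≤ i) (hj : j + 2 ≤ n)
    (hi' : δ + 2 ≤ i') (hj' : j' + 2 ≤ n) (huJ : ∀ k, i' ≤ k → k ≤ j' → ¬ G.Adj u (c k))
    (hvI : ∀ k, i ≤ k → k ≤ j → ¬ G.Adj v (c k)) (hf : IsFirst G δ c u f)
    (hg : IsFirst G δ c v g) (hfg : f + 2 ≤ g ∨ g + 2 ≤ f) :
    ¬ G.Adj u v ∧ ∃ k l d e, 0 < k ∧ l < δ ∧ ArcGap G c u v k l d e ∧ Even (l - k) := by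
  have huv : ¬ G.Adj u v := fun h => by
    have := hS.eq_first_of_adj hM hu hv h hI hJ hap hi hj hi' hj' huJ hvI hf hg
    omega
  refine ⟨huv, ?_⟩
  rcases hfg with h | h
  · exact hS.exists_even_gap_aux hM hu hv huv hI hJ hap hi hj hi' hj' huJ hvI hf hg h
  · obtain ⟨k, l, d, e, h1, h2, h3, h4⟩ := hS.exists_even_gap_aux hM hv hu (fun h => huv h.symm)
      hJ hI hap.symm hi' hj' hi hj hvI huJ hg hf h
    exact ⟨k, l, e, d, h1, h2, h3.symm, h4⟩

/-- The pyramid whose apex is the only neighbour in `[0, δ]` of `u`. -/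
lemma no_touching_of_unique (hS : Setup G ℓ n δ c x) (hu : Member G ℓ n δ c x u)
    (hv : Member G ℓ n δ c x v) (huv : ¬ G.Adj u v) (hI : ArcGap G c x u i j a b)
    (hJ : ArcGap G c x v i' j' a' b') (ht : Touch i j a i' j' a') (hi : δ + 2 ≤ i)
    (hj : j + 2 ≤ n) (hi' : δ + 2 ≤ i') (hj' : j' + 2 ≤ n)
    (huJ : ∀ k, i' ≤ k → k ≤ j' → ¬ G.Adj u (c k))
    (hvI : ∀ k, i ≤ k → k ≤ j → ¬ G.Adj v (c k)) (hlong : ℓ ≤ j - i + 1 ∨ ℓ ≤ j' - i' + 1)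
    (hf : IsFirst G δ c u f) (hg : IsFirst G δ c v g) (hfg : f < g)
    (huniq : ∀ k, 0 ≤ k → k ≤ δ → G.Adj u (c k) → k = f) : False := by
  have hδ := hS.delta_le
  have hδ' := hS.le_delta
  have hℓ := hS.five_le
  have hb := hS.first_bounds hu hf
  have hb' := hS.first_bounds hv hg
  have hIle := hI.le
  have hJle := hJ.le
  have hne : u ≠ v := by
    rintro rfl
    have := hf.unique hg
    omega
  have hout : ∀ {k k'}, 0 ≤ k → k < δ → δ + 2 ≤ k' → k' + 2 ≤ n →
      c k ≠ c k' ∧ ¬ G.Adj (c k) (c k') := fun {k k'} h1 h2 h3 h4 =>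
    hS.cyc.apart (n := n) (i := 0) (j := δ - 1) (i' := δ + 2) (j' := n - 2)
      (Or.inl ⟨by omega, by omega⟩) h1 (by omega) h3 (by omega)
  have hadj : G.Adj (c a) (c a') := by
    rcases ht with ⟨h, rfl, rfl⟩ | ⟨h, rfl, rfl⟩
    · exact (hS.cyc.adj _ _ (by omega) (by omega)).2 (Or.inl h.symm)
    · exact ((hS.cyc.adj _ _ (by omega) (by omega)).2 (Or.inl h.symm)).symm
  -- Here `u` has no neighbour beyond `f` from which to start a detour, so the apex moves to `c f`.
  -- The branches go back along `[0, f]` to `x`, through `u` and its gap, and along `[f, g]` through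
  -- `v` and its gap.
  have p₀ : IPath G (c '' Set.Icc 0 f ∪ {x}) (c f) x (f - 0 + 1) := by
    refine (hS.cyc.ipath hf.nonneg (by omega)).symm.snoc ?_ hS.adj_zero.symm ?_
    · rintro ⟨k, -, h⟩
      exact hS.off k h.symm
    · rintro _ ⟨k, ⟨h1, h2⟩, rfl⟩ h
      rcases eq_or_lt_of_le h1 with rfl | h1
      · rfl
      · exact absurd h.symm (hS.nadj k h1 (by omega))
  have p₁ : IPath G ({c f} ∪ (c '' Set.Icc i j ∪ {u})) (c f) (c a) (0 + (j - i + 1) + 1) := by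
    refine (IPath.single (c f)).join (hS.cyc.half_ipath hI (by omega) hu.off) hf.adj.symm ?_
    rintro _ rfl _ (⟨k, ⟨h1, h2⟩, rfl⟩ | rfl)
    · have := hout hf.nonneg (by omega) (k' := k) (by omega) (by omega)
      exact ⟨this.1, fun h => absurd h this.2⟩
    · exact ⟨(hu.off f).symm, fun _ => ⟨rfl, rfl⟩⟩
  have p₂ : IPath G (c '' Set.Icc f g ∪ (c '' Set.Icc i' j' ∪ {v})) (c f) (c a')
      ((g - f) + (j' - i' + 1) + 1) := by
    refine (hS.cyc.ipath hfg.le (by omega)).join (hS.cyc.half_ipath hJ (by omega) hv.off)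
      hg.adj.symm ?_
    rintro _ ⟨k', ⟨h3, h4⟩, rfl⟩ _ (⟨k, ⟨h1, h2⟩, rfl⟩ | rfl)
    · have := hout (k := k') (by omega) (by omega) (k' := k) (by omega) (by omega)
      exact ⟨this.1, fun h => absurd h this.2⟩
    · refine ⟨(hv.off k').symm, fun h => ⟨?_, rfl⟩⟩
      rcases eq_or_lt_of_le h4 with rfl | h4
      · rfl
      · exact absurd h.symm (hg.min k' (by omega) h4)
  have hlow : ∀ k, 0 ≤ k → k ≤ f → c k ≠ c f → ∀ k', f ≤ k' → k' ≤ g → c k' ≠ c f →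
      c k ≠ c k' ∧ ¬ G.Adj (c k) (c k') := by
    intro k h1 h2 h3 k' h4 h5 h6
    have h7 : k ≠ f := fun h => h3 (h ▸ rfl)
    have h8 : k' ≠ f := fun h => h6 (h ▸ rfl)
    exact hS.cyc.apart (n := n) (i := 0) (j := f - 1) (i' := f + 1) (j' := δ)
      (Or.inl ⟨by omega, by omega⟩) h1 (by omega) (by omega) (by omega)
  have d₀₁ : ∀ s ∈ c '' Set.Icc 0 f ∪ {x}, ∀ t ∈ {c f} ∪ (c '' Set.Icc i j ∪ {u}), s ≠ c f →
      t ≠ c f → s ≠ t ∧ (G.Adj s t → s = x ∧ t = c a) := by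
    rintro _ (⟨k, ⟨h1, h2⟩, rfl⟩ | rfl) _ (h | (⟨k', ⟨h3, h4⟩, rfl⟩ | rfl)) hne hne'
    · exact absurd h hne'
    · have := hout h1 (by omega) (k' := k') (by omega) (by omega)
      exact ⟨this.1, fun h => absurd h this.2⟩
    · refine ⟨(hu.off k).symm, fun h => absurd ?_ hne⟩
      rw [huniq k h1 (by omega) h.symm]
    · exact absurd h hne'
    · exact ⟨hS.off k', fun h => ⟨rfl, by rw [(hI.left k' h3 h4).1 h]⟩⟩
    · exact ⟨hu.ne.symm, fun h => absurd h hu.nadj⟩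
  have d₀₂ : ∀ s ∈ c '' Set.Icc 0 f ∪ {x}, ∀ t ∈ c '' Set.Icc f g ∪ (c '' Set.Icc i' j' ∪ {v}),
      s ≠ c f → t ≠ c f → s ≠ t ∧ (G.Adj s t → s = x ∧ t = c a') := by
    rintro _ (⟨k, ⟨h1, h2⟩, rfl⟩ | rfl) _ (⟨k', ⟨h3, h4⟩, rfl⟩ | (⟨k', ⟨h3, h4⟩, rfl⟩ | rfl))
      hne hne'
    · have := hlow k h1 h2 hne k' h3 h4 hne'
      exact ⟨this.1, fun h => absurd h this.2⟩
    · have := hout h1 (by omega) (k' := k') (by omega) (by omega)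
      exact ⟨this.1, fun h => absurd h this.2⟩
    · exact ⟨(hv.off k).symm, fun h => absurd h.symm (hg.min k h1 (by omega))⟩
    · exact ⟨hS.off k', fun h => absurd h (hS.nadj k' (by omega) (by omega))⟩
    · exact ⟨hS.off k', fun h => ⟨rfl, by rw [(hJ.left k' h3 h4).1 h]⟩⟩
    · exact ⟨hv.ne.symm, fun h => absurd h hv.nadj⟩
  have d₁₂ : ∀ s ∈ {c f} ∪ (c '' Set.Icc i j ∪ {u}),
      ∀ t ∈ c '' Set.Icc f g ∪ (c '' Set.Icc i' j' ∪ {v}),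
      s ≠ c f → t ≠ c f → s ≠ t ∧ (G.Adj s t → s = c a ∧ t = c a') := by
    rintro _ (h | (⟨k, ⟨h1, h2⟩, rfl⟩ | rfl)) _ (⟨k', ⟨h3, h4⟩, rfl⟩ | (⟨k', ⟨h3, h4⟩, rfl⟩ | rfl))
      hne hne'
    all_goals try exact absurd h hne
    · have := hout (k := k') (by omega) (by omega) (k' := k) (by omega) (by omega)
      exact ⟨this.1.symm, fun h => absurd h.symm this.2⟩
    · exact hS.cyc.touch ht (by omega) (by omega) h1 h2 h3 h4
    · exact ⟨(hv.off k).symm, fun h => absurd h.symm (hvI k h1 h2)⟩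
    · refine ⟨hu.off k', fun h => absurd ?_ hne'⟩
      rw [huniq k' (by omega) (by omega) h]
    · exact ⟨hu.off k', fun h => absurd h (huJ k' h3 h4)⟩
    · exact ⟨‹_›, fun h => absurd h huv⟩
  rcases hlong with hlong | hlong
  · exact not_hasLongPyramid_paths hS.pyr p₀ p₁ p₂ (hS.off f) (hout hf.nonneg (by omega)
      (by rcases hI.ends with h | h <;> omega) (by rcases hI.ends with h | h <;> omega)).1.symm
      (hout hf.nonneg (by omega)
      (by rcases hJ.ends with h | h <;> omega) (by rcases hJ.ends with h | h <;> omega)).1.symm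
      hI.adj_left hJ.adj_left hadj (by omega) (by omega) d₀₁ d₀₂ d₁₂
  · refine not_hasLongPyramid_paths hS.pyr p₀ p₂ p₁ (hS.off f) (hout hf.nonneg (by omega)
      (by rcases hJ.ends with h | h <;> omega) (by rcases hJ.ends with h | h <;> omega)).1.symm
      (hout hf.nonneg (by omega)
      (by rcases hI.ends with h | h <;> omega) (by rcases hI.ends with h | h <;> omega)).1.symm
      hJ.adj_left hI.adj_left hadj.symm (by omega) (by omega) d₀₂ d₀₁ ?_
    intro s hs t ht h1 h2
    have := d₁₂ t ht s hs h2 h1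
    exact ⟨this.1.symm, fun h => (this.2 h.symm).symm⟩

/-- Members with consecutive gaps to `x`, one of them long, have close first neighbours. -/
lemma not_far_of_touch_aux (hS : Setup G ℓ n δ c x) (hM : Family G ℓ n δ c x M p) (hu : u ∈ M)
    (hv : v ∈ M) (hI : ArcGap G c x u i j a b) (hJ : ArcGap G c x v i' j' a' b')
    (ht : Touch i j a i' j' a') (hi : δ + 2 ≤ i) (hj : j + 2 ≤ n)
    (hi' : δ + 2 ≤ i') (hj' : j' + 2 ≤ n) (huJ : ∀ k, i' ≤ k → k ≤ j' → ¬ G.Adj u (c k))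
    (hvI : ∀ k, i ≤ k → k ≤ j → ¬ G.Adj v (c k)) (hlong : ℓ ≤ j - i + 1 ∨ ℓ ≤ j' - i' + 1)
    (hf : IsFirst G δ c u f) (hg : IsFirst G δ c v g) : ¬ f + 2 ≤ g := by
  intro hfg
  have mu := hM.member u hu
  have mv := hM.member v hv
  have hvf : ∀ k, 0 ≤ k → k ≤ f → ¬ G.Adj v (c k) := fun k h1 h2 => hg.min k h1 (by omega)
  by_cases huv : G.Adj u v
  · exact hS.no_touching_detour mu mv hI hJ ht hi hj hi' hj' huJ hvI hlong hf hvf (edge_detour huv)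
  rcases hM.spread u hu f hf with h | h
  · exact hS.no_touching_of_unique mu mv huv hI hJ ht hi hj hi' hj' huJ hvI hlong hf hg (by omega) h
  · obtain ⟨_, _, _, _, _, _, _, Z, hZ⟩ := hS.exists_detour mu mv huv hf hg hfg h
    exact hS.no_touching_detour mu mv hI hJ ht hi hj hi' hj' huJ hvI hlong hf hvf hZ

lemma not_far_of_touch (hS : Setup G ℓ n δ c x) (hM : Family G ℓ n δ c x M p) (hu : u ∈ M)
    (hv : v ∈ M) (hI : ArcGap G c x u i j a b) (hJ : ArcGap G c x v i' j' a' b')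
    (ht : Touch i j a i' j' a') (hi : δ + 2 ≤ i) (hj : j + 2 ≤ n)
    (hi' : δ + 2 ≤ i') (hj' : j' + 2 ≤ n) (huJ : ∀ k, i' ≤ k → k ≤ j' → ¬ G.Adj u (c k))
    (hvI : ∀ k, i ≤ k → k ≤ j → ¬ G.Adj v (c k)) (hlong : ℓ ≤ j - i + 1 ∨ ℓ ≤ j' - i' + 1)
    (hf : IsFirst G δ c u f) (hg : IsFirst G δ c v g) : f < g + 2 ∧ g < f + 2 := by
  have h1 := hS.not_far_of_touch_aux hM hu hv hI hJ ht hi hj hi' hj' huJ hvI hlong hf hg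
  have h2 := hS.not_far_of_touch_aux hM hv hu hJ hI ht.symm hi' hj' hi hj hvI huJ hlong.symm hg hf
  omega

/-- A member with two consecutive gaps to `x`, one of them long, is the apex of a pyramid. -/
lemma no_touching_gaps (hS : Setup G ℓ n δ c x) (hu : Member G ℓ n δ c x u)
    (hI : ArcGap G c x u i j a b) (hJ : ArcGap G c x u i' j' a' b')
    (ht : Touch i j a i' j' a') (hi : δ + 2 ≤ i)
    (hj : j + 2 ≤ n) (hi' : δ + 2 ≤ i') (hj' : j' + 2 ≤ n) (hlong : ℓ ≤ j - i + 1) : False := by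
  obtain ⟨f, hf⟩ := hu.exists_isFirst
  have hδ := hS.delta_le
  have hδ' := hS.le_delta
  have hℓ := hS.five_le
  have hb := hS.first_bounds hu hf
  have hIle := hI.le
  have hJle := hJ.le
  have hout : ∀ {k k'}, 0 ≤ k → k < δ → δ + 2 ≤ k' → k' + 2 ≤ n →
      c k ≠ c k' ∧ ¬ G.Adj (c k) (c k') := fun {k k'} h1 h2 h3 h4 =>
    hS.cyc.apart (n := n) (i := 0) (j := δ - 1) (i' := δ + 2) (j' := n - 2)
      (Or.inl ⟨by omega, by omega⟩) h1 (by omega) h3 (by omega)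
  have hadj : G.Adj (c a) (c a') := by
    rcases ht with ⟨h, rfl, rfl⟩ | ⟨h, rfl, rfl⟩
    · exact (hS.cyc.adj _ _ (by omega) (by omega)).2 (Or.inl h.symm)
    · exact ((hS.cyc.adj _ _ (by omega) (by omega)).2 (Or.inl h.symm)).symm
  have key : ∀ {i j a b}, ArcGap G c x u i j a b → δ + 2 ≤ i → j + 2 ≤ n →
      ∀ s ∈ (c '' Set.Icc 0 f ∪ {u}) ∪ {x}, ∀ t ∈ c '' Set.Icc i j ∪ {u}, s ≠ u → t ≠ u →
      s ≠ t ∧ (G.Adj s t → s = x ∧ t = c a) := by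
    intro i j a b hI hi hj
    rintro _ ((⟨k, ⟨h1, h2⟩, rfl⟩ | h) | rfl) _ (⟨k', ⟨h3, h4⟩, rfl⟩ | h') hne hne'
    all_goals try exact absurd h hne
    all_goals try exact absurd h' hne'
    · have := hout h1 (by omega) (k' := k') (by omega) (by omega)
      exact ⟨this.1, fun h => absurd h this.2⟩
    · exact ⟨hS.off k', fun h => ⟨rfl, by rw [(hI.left k' h3 h4).1 h]⟩⟩
  refine not_hasLongPyramid_paths hS.pyr (hS.stem hu hf) (hS.cyc.half_ipath hI (by omega) hu.off)
    (hS.cyc.half_ipath hJ (by omega) hu.off) hu.ne.symm (hu.off a).symm (hu.off a').symm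
    hI.adj_left hJ.adj_left hadj (by omega) (by omega) (key hI hi hj) (key hJ hi' hj') ?_
  rintro _ (⟨k, ⟨h1, h2⟩, rfl⟩ | h) _ (⟨k', ⟨h3, h4⟩, rfl⟩ | h') hne hne'
  all_goals try exact absurd h hne
  all_goals try exact absurd h' hne'
  exact hS.cyc.touch ht (by omega) (by omega) h1 h2 h3 h4

end Setup

end LongOddHole

/-! ### Catching all members by arcs around the odd gap and around first neighbours. -/

namespace LongOddHole

open SimpleGraph

variable {V : Type*} {G : SimpleGraph V}
variable {ℓ : ℕ} {n δ : ℤ} {c : ℤ → V} {x u v w v₁ v₂ : V} {M : Set V} {p : Prop}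
variable {s t x₁ x₂ f₁ f₂ : ℤ}

/-- The arc `[s, t]` is an odd gap between the adjacent members `v₁`, `v₂` of `M`, and `x` and all
members of `M` have neighbours in it. -/
structure OddGap (G : SimpleGraph V) (ℓ : ℕ) (n δ : ℤ) (c : ℤ → V) (x : V) (M : Set V) (s t : ℤ)
    (v₁ v₂ : V) : Prop where
  left_far : δ + ℓ ≤ s
  right_far : t + ℓ ≤ n
  odd : Odd (t - s)
  mem₁ : v₁ ∈ M
  mem₂ : v₂ ∈ M
  adj : G.Adj v₁ v₂
  gap : ArcGap G c v₁ v₂ s t s t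
  meets_x : ∃ k, s ≤ k ∧ k ≤ t ∧ G.Adj x (c k)
  meets : ∀ u ∈ M, ∃ k, s ≤ k ∧ k ≤ t ∧ G.Adj u (c k)

/-- `w` has a neighbour in the interior of the arc `I`. -/
def Caught (G : SimpleGraph V) (c : ℤ → V) (w : V) (I : ℤ × ℤ) : Prop :=
  ∃ k, I.1 < k ∧ k < I.2 ∧ G.Adj w (c k)

lemma not_caught {I : ℤ × ℤ} (h : ¬ Caught G c w I) {k : ℤ} (hk : G.Adj w (c k)) :
    k ≤ I.1 ∨ I.2 ≤ k := by
  by_contra h'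
  push Not at h'
  exact h ⟨k, h'.1, h'.2, hk⟩

namespace Setup

section

variable (hS : Setup G ℓ n δ c x) (hM : Family G ℓ n δ c x M p)
  (hQ : OddGap G ℓ n δ c x M s t v₁ v₂)
include hS hM hQ

/-- If `x` has exactly two neighbours in the odd gap, and they are adjacent. -/
lemma caught_of_adjacent (h1 : s ≤ x₁) (h2 : x₁ + 1 ≤ t)
    (hx : ∀ k, s ≤ k → k ≤ t → (G.Adj x (c k) ↔ k = x₁ ∨ k = x₁ + 1))
    (hf₁ : IsFirst G δ c v₁ f₁) (hf₂ : IsFirst G δ c v₂ f₂) (hw : w ∈ M) :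
    Caught G c w (x₁ - ℓ, x₁ + 1 + ℓ) ∨ Caught G c w (f₁ - 2, f₁ + 2) ∨
      Caught G c w (f₂ - 2, f₂ + 2) := by
  by_contra hcon
  push Not at hcon
  obtain ⟨c₁, c₂, c₃⟩ := hcon
  have hℓ := hS.five_le
  have q1 := hQ.left_far
  have q2 := hQ.right_far
  obtain ⟨f, hf⟩ := (hM.member w hw).exists_isFirst
  have e₂ := not_caught c₂ hf.adj
  have e₃ := not_caught c₃ hf.adj
  simp only at e₂ e₃
  have g₁ : ArcGap G c x v₁ s x₁ x₁ s := ⟨h1, Or.inr ⟨rfl, rfl⟩,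
    fun k h3 h4 => (hx k h3 (by omega)).trans (by omega),
    fun k h3 h4 => hQ.gap.left k h3 (by omega)⟩
  have g₂ : ArcGap G c x v₂ (x₁ + 1) t (x₁ + 1) t := ⟨h2, Or.inl ⟨rfl, rfl⟩,
    fun k h3 h4 => (hx k (by omega) h4).trans (by omega),
    fun k h3 h4 => hQ.gap.right k (by omega) h4⟩
  have left : (∃ k, s ≤ k ∧ k ≤ x₁ ∧ G.Adj w (c k)) →
      ∃ h, s ≤ h ∧ h + ℓ ≤ x₁ ∧ ArcGap G c x w h x₁ x₁ h := by
    intro h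
    obtain ⟨k, h3, h4, h5, h6⟩ := exists_greatest h
    have h7 := not_caught c₁ h5
    simp only at h7
    refine ⟨k, h3, by omega, by omega, Or.inr ⟨rfl, rfl⟩,
      fun m h3 h4 => (hx m (by omega) (by omega)).trans (by omega), fun m h8 h9 => ⟨fun h => ?_,
      fun h => h ▸ h5⟩⟩
    by_contra hne
    exact h6 m (by omega) h9 h
  have right : (∃ k, x₁ + 1 ≤ k ∧ k ≤ t ∧ G.Adj w (c k)) →
      ∃ h, h ≤ t ∧ x₁ + 1 + ℓ ≤ h ∧ ArcGap G c x w (x₁ + 1) h (x₁ + 1) h := by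
    intro h
    obtain ⟨k, h3, h4, h5, h6⟩ := exists_least h
    have h7 := not_caught c₁ h5
    simp only at h7
    refine ⟨k, h4, by omega, by omega, Or.inl ⟨rfl, rfl⟩,
      fun m h3 h4 => (hx m (by omega) (by omega)).trans (by omega), fun m h8 h9 => ⟨fun h => ?_,
      fun h => h ▸ h5⟩⟩
    by_contra hne
    exact h6 m h8 (by omega) h
  -- Neighbours of `w` on both sides of the pair give two touching long gaps from `w`. On one side
  -- only, the long gap of `w` touches the gap of `v₂` or `v₁` on the other side, so the first
  -- neighbours are close, against `c₃` or `c₂`.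
  by_cases hl : ∃ k, s ≤ k ∧ k ≤ x₁ ∧ G.Adj w (c k) <;>
    by_cases hr : ∃ k, x₁ + 1 ≤ k ∧ k ≤ t ∧ G.Adj w (c k)
  · obtain ⟨h, l1, l2, l3⟩ := left hl
    obtain ⟨h', r1, r2, r3⟩ := right hr
    exact hS.no_touching_gaps (hM.member w hw) l3 r3 (Or.inl ⟨rfl, rfl, rfl⟩) (by omega) (by omega)
      (by omega) (by omega) (by omega)
  · obtain ⟨h, l1, l2, l3⟩ := left hl
    have := hS.not_far_of_touch hM hw hQ.mem₂ l3 g₂ (Or.inl ⟨rfl, rfl, rfl⟩) (by omega) (by omega)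
      (by omega) (by omega) (fun k h3 h4 h5 => hr ⟨k, h3, h4, h5⟩)
      (fun k h3 h4 h5 => by have := (hQ.gap.right k (by omega) (by omega)).1 h5; omega)
      (Or.inl (by omega)) hf hf₂
    omega
  · obtain ⟨h, r1, r2, r3⟩ := right hr
    have := hS.not_far_of_touch hM hw hQ.mem₁ r3 g₁ (Or.inr ⟨rfl, rfl, rfl⟩) (by omega) (by omega)
      (by omega) (by omega) (fun k h3 h4 h5 => hl ⟨k, h3, h4, h5⟩)
      (fun k h3 h4 h5 => by have := (hQ.gap.left k (by omega) (by omega)).1 h5; omega)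
      (Or.inl (by omega)) hf hf₁
    omega
  · obtain ⟨k, h3, h4, h5⟩ := hQ.meets w hw
    by_cases h6 : k ≤ x₁
    · exact hl ⟨k, h3, h6, h5⟩
    · exact hr ⟨k, by omega, h4, h5⟩

/-- A member of `M` whose neighbours in the odd gap are far from its ends has exactly two
neighbours there, which are adjacent and at even distance from the ends of the gap. -/
lemma exists_pair_of_uncaught (h1 : s ≤ x₁) (h2 : x₁ ≤ x₂) (h3 : x₂ ≤ t)
    (hx₁ : G.Adj x (c x₁)) (hx₂ : G.Adj x (c x₂))
    (hx : ∀ k, s ≤ k → k ≤ t → G.Adj x (c k) → x₁ ≤ k ∧ k ≤ x₂)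
    (hshort : (x₁ - s) + (t - x₂) + 5 < ℓ)
    (hf₁ : IsFirst G δ c v₁ f₁) (hf₂ : IsFirst G δ c v₂ f₂) (hw : w ∈ M)
    (c₁ : ¬ Caught G c w (s - 1, s + ℓ - 4)) (c₂ : ¬ Caught G c w (t - ℓ + 4, t + 1))
    (c₃ : ¬ Caught G c w (f₁ - 2, f₁ + 2)) (c₄ : ¬ Caught G c w (f₂ - 2, f₂ + 2)) :
    ∃ h, s ≤ h ∧ h + 1 ≤ t ∧ (∀ k, s ≤ k → k ≤ t → (G.Adj w (c k) ↔ k = h ∨ k = h + 1)) ∧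
      Even (h - s) ∧ (∃ y, s ≤ y ∧ ArcGap G c x w y h y h) ∧
      ∃ y, y ≤ t ∧ ArcGap G c x w (h + 1) y y (h + 1) := by
  have hℓ := hS.five_le
  have hδ := hS.le_delta
  have q1 := hQ.left_far
  have q2 := hQ.right_far
  have mw := hM.member w hw
  have m₁ := hM.member v₁ hQ.mem₁
  have m₂ := hM.member v₂ hQ.mem₂
  obtain ⟨f, hf⟩ := mw.exists_isFirst
  have e₃ := not_caught c₃ hf.adj
  have e₄ := not_caught c₄ hf.adj
  simp only at e₃ e₄
  have hpos : ∀ k, s ≤ k → k ≤ t → G.Adj w (c k) → s + ℓ - 4 ≤ k ∧ k ≤ t - ℓ + 4 := by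
    intro k h4 h5 h6
    have e₁ := not_caught c₁ h6
    have e₂ := not_caught c₂ h6
    simp only at e₁ e₂
    omega
  obtain ⟨i, i1, i2, i3, i4⟩ := exists_least (hQ.meets w hw)
  obtain ⟨j, j1, j2, j3, j4⟩ := exists_greatest (hQ.meets w hw)
  have pi := hpos i i1 i2 i3
  have pj := hpos j j1 j2 j3
  have hij : i ≤ j := by
    by_contra h
    exact i4 j j1 (by omega) j3
  obtain ⟨y, y1, y2, y3, y4⟩ := exists_greatest (P := fun k => G.Adj x (c k))
    ⟨x₁, h1, (by omega : x₁ ≤ i), hx₁⟩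
  obtain ⟨z, z1, z2, z3, z4⟩ := exists_least (P := fun k => G.Adj x (c k))
    ⟨x₂, (by omega : j ≤ x₂), h3, hx₂⟩
  have hy : ArcGap G c x w y i y i := ⟨y2, Or.inl ⟨rfl, rfl⟩, fun k h4 h5 => ⟨fun h => by
    by_contra hne; exact y4 k (by omega) h5 h, fun h => h ▸ y3⟩, fun k h4 h5 => ⟨fun h => by
    by_contra hne; exact i4 k (by omega) (by omega) h, fun h => h ▸ i3⟩⟩
  have hz : ArcGap G c x w j z z j := ⟨z1, Or.inr ⟨rfl, rfl⟩, fun k h4 h5 => ⟨fun h => by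
    by_contra hne; exact z4 k h4 (by omega) h, fun h => h ▸ z3⟩, fun k h4 h5 => ⟨fun h => by
    by_contra hne; exact j4 k (by omega) (by omega) h, fun h => h ▸ j3⟩⟩
  have g₁ : ArcGap G c x v₁ s x₁ x₁ s := ⟨h1, Or.inr ⟨rfl, rfl⟩,
    fun k h4 h5 => ⟨fun h => by have := hx k h4 (by omega) h; omega, fun h => h ▸ hx₁⟩,
    fun k h4 h5 => hQ.gap.left k h4 (by omega)⟩
  have g₂ : ArcGap G c x v₂ x₂ t x₂ t := ⟨h3, Or.inl ⟨rfl, rfl⟩,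
    fun k h4 h5 => ⟨fun h => by have := hx k (by omega) h5 h; omega, fun h => h ▸ hx₂⟩,
    fun k h4 h5 => hQ.gap.right k (by omega) h5⟩
  -- To be apart from the gap `[s, x₁]` of `v₁`, the gap of `w` is taken on the far side, `[j, z]`;
  -- for `v₂` it is `[y, i]`.
  obtain ⟨n₁, k, l, d, e, o1, o2, o3, o4⟩ := hS.exists_even_gap hM hw hQ.mem₁ hz g₁
    (Or.inr ⟨by omega, by omega⟩) (by omega) (by omega) (by omega) (by omega)
    (fun k h4 h5 h6 => i4 k h4 (by omega) h6)
    (fun k h4 h5 h6 => by have := (hQ.gap.left k (by omega) (by omega)).1 h6; omega) hf hf₁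
    (by omega)
  obtain ⟨n₂, k', l', d', e', o1', o2', o3', o4'⟩ := hS.exists_even_gap hM hw hQ.mem₂ hy g₂
    (Or.inl ⟨by omega, by omega⟩) (by omega) (by omega) (by omega) (by omega)
    (fun k h4 h5 h6 => j4 k (by omega) h5 h6)
    (fun k h4 h5 h6 => by have := (hQ.gap.right k (by omega) (by omega)).1 h6; omega) hf hf₂
    (by omega)
  have l₁ : ArcGap G c w v₁ s i i s := ⟨i1, Or.inr ⟨rfl, rfl⟩,
    fun k h4 h5 => ⟨fun h => by by_contra hne; exact i4 k h4 (by omega) h, fun h => h ▸ i3⟩,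
    fun k h4 h5 => hQ.gap.left k h4 (by omega)⟩
  have l₂ : ArcGap G c w v₂ j t j t := ⟨j2, Or.inl ⟨rfl, rfl⟩,
    fun k h4 h5 => ⟨fun h => by by_contra hne; exact j4 k (by omega) h5 h, fun h => h ▸ j3⟩,
    fun k h4 h5 => hQ.gap.right k (by omega) h5⟩
  have ne₁ : v₁ ≠ w := by
    rintro rfl
    have := (hQ.gap.left s le_rfl (by omega)).2 rfl
    have := hpos s le_rfl (by omega) this
    omega
  have ne₂ : v₂ ≠ w := by
    rintro rfl
    have := (hQ.gap.right t (by omega) le_rfl).2 rfl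
    have := hpos t (by omega) le_rfl this
    omega
  have le := o3.le
  have le' := o3'.le
  -- The even gaps inside `[0, δ]` make `i - s` and `t - j` even. The holes used are long because
  -- each of these is at least `ℓ - 4`.
  have w₁ := hS.even.two_gaps hS.cyc o3 l₁ (Or.inl ⟨by omega, by omega⟩) mw.off m₁.off ne₁ n₁
    (by omega) (by omega)
  have w₂ := hS.even.two_gaps hS.cyc o3' l₂ (Or.inl ⟨by omega, by omega⟩) mw.off m₂.off ne₂ n₂
    (by omega) (by omega)
  have hodd := hQ.odd
  rw [Int.even_iff] at o4 o4' w₁ w₂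
  rw [Int.odd_iff] at hodd
  -- Now `j - i` is odd. If it were not 1, the hole through `w`, `v₁`, `v₂` and the arcs `[s, i]`,
  -- `[j, t]` would be long, odd and shorter than the cycle.
  have hj : j = i + 1 := by
    by_contra hne
    have hne' : j ≠ i := by omega
    have := hS.even.adjacent_gaps hS.cyc l₁ l₂ (Or.inl ⟨by omega, by omega⟩) mw.off m₁.off m₂.off
      ne₁ ne₂ n₁ n₂ hQ.adj
      (fun k h4 h5 h6 => by have := (hQ.gap.left k (by omega) (by omega)).1 h6; omega)
      (fun k h4 h5 h6 => by have := (hQ.gap.right k (by omega) (by omega)).1 h6; omega)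
      (by omega) (by omega)
    rw [Int.even_iff] at this
    omega
  subst hj
  refine ⟨i, i1, j2, fun k h4 h5 => ⟨fun h => ?_, ?_⟩, ?_, ⟨y, y1, hy⟩, ⟨z, z2, hz⟩⟩
  · by_contra hne
    by_cases h6 : k < i
    · exact i4 k h4 h6 h
    · exact j4 k (by omega) h5 h
  · rintro (rfl | rfl)
    · exact i3
    · exact j3
  · rw [Int.even_iff]
    omega

omit hM in
/-- The adjacent neighbours of two such members of `M` cannot be far apart. -/
lemma pairs_close (hM : Family G ℓ n δ c x M p) {w w' : V} (hw : w ∈ M) (hw' : w' ∈ M) {f f' : ℤ}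
    (hf : IsFirst G δ c w f) (hf' : IsFirst G δ c w' f') (hff : f + 2 ≤ f' ∨ f' + 2 ≤ f)
    {h h' y y' : ℤ}
    (e : ∀ k, s ≤ k → k ≤ t → (G.Adj w (c k) ↔ k = h ∨ k = h + 1))
    (e' : ∀ k, s ≤ k → k ≤ t → (G.Adj w' (c k) ↔ k = h' ∨ k = h' + 1))
    (o : Even (h - s)) (o' : Even (h' - s)) (sy : s ≤ y) (ty : y' ≤ t)
    (hy : ArcGap G c x w y h y h) (hy' : ArcGap G c x w' (h' + 1) y' y' (h' + 1)) :
    h' < h + ℓ - 3 := by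
  by_contra hfar
  have hℓ := hS.five_le
  have hδ := hS.le_delta
  have q1 := hQ.left_far
  have q2 := hQ.right_far
  have le := hy.le
  have le' := hy'.le
  obtain ⟨n₁, k, l, d, e₁, o1, o2, o3, o4⟩ := hS.exists_even_gap hM hw hw' hy hy'
    (Or.inl ⟨by omega, by omega⟩) (by omega) (by omega) (by omega) (by omega)
    (fun k h4 h5 h6 => by have := (e k (by omega) (by omega)).1 h6; omega)
    (fun k h4 h5 h6 => by have := (e' k (by omega) (by omega)).1 h6; omega) hf hf' hff
  -- This gap is odd, since `h - s` and `h' - s` are even. Its length is at least `ℓ - 4`, so with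
  -- the even gap inside `[0, δ]` it closes to a long odd hole.
  have l₁ : ArcGap G c w w' (h + 1) h' (h + 1) h' := ⟨by omega, Or.inl ⟨rfl, rfl⟩,
    fun k h4 h5 => (e k (by omega) (by omega)).trans (by omega),
    fun k h4 h5 => (e' k (by omega) (by omega)).trans (by omega)⟩
  have le₁ := o3.le
  have ne₁ : w' ≠ w := by
    rintro rfl
    have := hf.unique hf'
    omega
  have w₁ := hS.even.two_gaps hS.cyc o3 l₁ (Or.inl ⟨by omega, by omega⟩) (hM.member w hw).off
    (hM.member w' hw').off ne₁ n₁ (by omega) (by omega)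
  rw [Int.even_iff] at o o' o4 w₁
  omega

/-- All members of `M` are caught by few arcs with few vertices. -/
theorem exists_catching_arcs :
    ∃ L : List (ℤ × ℤ), (∀ I ∈ L, I.1 ≤ I.2 ∧ I.2 < I.1 + n) ∧
      (L.map fun I => I.2 - I.1 + 1).sum ≤ 5 * (ℓ : ℤ) + 12 ∧ ∀ w ∈ M, ∃ I ∈ L, Caught G c w I := by
  have hℓ := hS.five_le
  have hδ := hS.le_delta
  have hδ' := hS.delta_le
  have q1 := hQ.left_far
  have q2 := hQ.right_far
  have hodd := hQ.odd
  have m₁ := hM.member v₁ hQ.mem₁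
  have m₂ := hM.member v₂ hQ.mem₂
  obtain ⟨f₁, hf₁⟩ := m₁.exists_isFirst
  obtain ⟨f₂, hf₂⟩ := m₂.exists_isFirst
  obtain ⟨x₁, a1, a2, a3, a4⟩ := exists_least hQ.meets_x
  obtain ⟨x₂, b1, b2, b3, b4⟩ := exists_greatest hQ.meets_x
  have h12 : x₁ ≤ x₂ := by
    by_contra h
    exact a4 x₂ b1 (by omega) b3
  have hx : ∀ k, s ≤ k → k ≤ t → G.Adj x (c k) → x₁ ≤ k ∧ k ≤ x₂ := by
    intro k h1 h2 h3
    constructor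
    · by_contra h
      exact a4 k h1 (by omega) h3
    · by_contra h
      exact b4 k (by omega) h2 h3
  have g₁ : ArcGap G c x v₁ s x₁ x₁ s := ⟨a1, Or.inr ⟨rfl, rfl⟩,
    fun k h4 h5 => ⟨fun h => by have := hx k h4 (by omega) h; omega, fun h => h ▸ a3⟩,
    fun k h4 h5 => hQ.gap.left k h4 (by omega)⟩
  have g₂ : ArcGap G c x v₂ x₂ t x₂ t := ⟨b2, Or.inl ⟨rfl, rfl⟩,
    fun k h4 h5 => ⟨fun h => by have := hx k (by omega) h5 h; omega, fun h => h ▸ b3⟩,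
    fun k h4 h5 => hQ.gap.right k (by omega) h5⟩
  -- Equal parity of `[s, x₁]` and `[x₂, t]`, together with `t - s` odd, makes `x₂ - x₁` odd.
  have hpar := (hM.par_gap v₁ hQ.mem₁ _ _ _ _ g₁ (by omega) (by omega)).trans
    (hM.par_gap v₂ hQ.mem₂ _ _ _ _ g₂ (by omega) (by omega)).symm
  rw [Int.even_iff, Int.even_iff] at hpar
  rw [Int.odd_iff] at hodd
  by_cases hnear : x₂ ≤ x₁ + 1
  · obtain rfl : x₂ = x₁ + 1 := by omega
    -- The total is `(2ℓ + 2) + 5 + 5 = 2ℓ + 12`.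
    refine ⟨[(x₁ - ℓ, x₁ + 1 + ℓ), (f₁ - 2, f₁ + 2), (f₂ - 2, f₂ + 2)], ?_, ?_, ?_⟩
    · simp only [List.mem_cons, List.not_mem_nil, or_false]
      rintro I (rfl | rfl | rfl) <;> constructor <;> dsimp only <;> omega
    · simp only [List.map_cons, List.map_nil, List.sum_cons, List.sum_nil]
      omega
    · intro w hw
      have := hS.caught_of_adjacent hM hQ a1 b2 (fun k h1 h2 => ⟨fun h => by
        have := hx k h1 h2 h; omega, by rintro (rfl | rfl) <;> assumption⟩) hf₁ hf₂ hw
      simpa using this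
  -- The left side is the length of the hole through `x`, `v₁`, `v₂` and the outer parts of the odd
  -- gap; it is odd and less than `n`.
  have hshort : (x₁ - s) + (t - x₂) + 5 < ℓ := by
    by_contra hlong
    have := hS.even.adjacent_gaps hS.cyc g₁ g₂ (Or.inl ⟨by omega, by omega⟩) hS.off m₁.off m₂.off
      m₁.ne m₂.ne m₁.nadj m₂.nadj hQ.adj
      (fun k h4 h5 h6 => by have := (hQ.gap.left k (by omega) (by omega)).1 h6; omega)
      (fun k h4 h5 h6 => by have := (hQ.gap.right k (by omega) (by omega)).1 h6; omega)
      (by omega) (by omega)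
    rw [Int.even_iff] at this
    omega
  -- Only interior vertices catch, so the first two arcs reach one vertex beyond the odd gap. By
  -- `hshort`, `x₁ ≤ s + ℓ - 6`, so an uncaught neighbour, at `s + ℓ - 4` or later, is apart from
  -- `[s, x₁]`; the other end is symmetric. The total is `2ℓ + 6`.
  let L₀ : List (ℤ × ℤ) := [(s - 1, s + ℓ - 4), (t - ℓ + 4, t + 1), (f₁ - 2, f₁ + 2), (f₂ - 2, f₂ + 2)]
  have hL₀ : ∀ I ∈ L₀, I.1 ≤ I.2 ∧ I.2 < I.1 + n := by
    simp only [L₀, List.mem_cons, List.not_mem_nil, or_false]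
    rintro I (rfl | rfl | rfl | rfl) <;> constructor <;> dsimp only <;> omega
  by_cases hall : ∀ w ∈ M, ∃ I ∈ L₀, Caught G c w I
  · refine ⟨L₀, hL₀, ?_, hall⟩
    simp only [L₀, List.map_cons, List.map_nil, List.sum_cons, List.sum_nil]
    omega
  push Not at hall
  obtain ⟨w, hw, hunc⟩ := hall
  have main : ∀ w ∈ M, (∀ I ∈ L₀, ¬ Caught G c w I) → _ := fun w hw hunc =>
    hS.exists_pair_of_uncaught hM hQ a1 h12 b2 a3 b3 hx hshort hf₁ hf₂ hw
    (hunc _ (by simp [L₀])) (hunc _ (by simp [L₀])) (hunc _ (by simp [L₀])) (hunc _ (by simp [L₀]))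
  obtain ⟨h, r1, r2, r3, r4, ⟨y, y1, y2⟩, ⟨z, z1, z2⟩⟩ := main w hw hunc
  obtain ⟨f, hf⟩ := (hM.member w hw).exists_isFirst
  -- The two new arcs have `2ℓ - 3` and 5 vertices, so the total is `4ℓ + 8`. A member missed by all
  -- the arcs has a pair at distance at least `ℓ - 2` from `h` and a first neighbour at distance at
  -- least 2 from `f`.
  refine ⟨L₀ ++ [(h - ℓ + 2, h + ℓ - 2), (f - 2, f + 2)], ?_, ?_, ?_⟩
  · simp only [List.mem_append, List.mem_cons, List.not_mem_nil, or_false]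
    rintro I (hI | rfl | rfl)
    · exact hL₀ I hI
    all_goals constructor <;> dsimp only <;> omega
  · simp only [L₀, List.map_append, List.map_cons, List.map_nil, List.sum_append, List.sum_cons,
      List.sum_nil]
    omega
  · intro w' hw'
    by_contra hcon
    push Not at hcon
    have c₁ : ¬ Caught G c w' (h - ℓ + 2, h + ℓ - 2) := hcon _ (by simp)
    have c₂ : ¬ Caught G c w' (f - 2, f + 2) := hcon _ (by simp)
    obtain ⟨h', r1', r2', r3', r4', ⟨y', y1', y2'⟩, ⟨z', z1', z2'⟩⟩ := main w' hw'
      (fun I hI => hcon I (List.mem_append_left _ hI))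
    obtain ⟨f', hf'⟩ := (hM.member w' hw').exists_isFirst
    have k₁ := not_caught c₁ ((r3' h' r1' (by omega)).2 (Or.inl rfl))
    have k₂ := not_caught c₂ hf'.adj
    simp only at k₁ k₂
    have := hS.pairs_close hQ hM hw hw' hf hf' (by omega) r3 r3' r4 r4' y1 z1' y2 z2'
    have := hS.pairs_close hQ hM hw' hw hf' hf (by omega) r3' r3 r4' r4 y1' z1 y2' z2
    omega

end

end Setup

end LongOddHole

/-! ### All gaps between `x` and one member have the same parity. -/

namespace LongOddHole

open SimpleGraph

variable {V : Type*} {G : SimpleGraph V}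
variable {ℓ : ℕ} {n δ : ℤ} {c : ℤ → V} {x u : V} {M : Set V} {f g : ℤ}

/-- `g` is the position of the last neighbour of `u` in the arc `[0, δ]`. -/
structure IsLast (G : SimpleGraph V) (δ : ℤ) (c : ℤ → V) (u : V) (g : ℤ) : Prop where
  nonneg : 0 ≤ g
  le : g ≤ δ
  adj : G.Adj u (c g)
  max : ∀ k, g < k → k ≤ δ → ¬ G.Adj u (c k)

lemma Member.exists_isLast (h : Member G ℓ n δ c x u) : ∃ g, IsLast G δ c u g := by
  obtain ⟨g, h1, h2, h3, h4⟩ := exists_greatest h.meets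
  exact ⟨g, h1, h2, h3, h4⟩

namespace Setup

lemma last_bounds (hS : Setup G ℓ n δ c x) (hu : Member G ℓ n δ c x u) (hg : IsLast G δ c u g) :
    ℓ ≤ g ∧ g + ℓ ≤ δ := by
  have := hS.delta_le
  have := hS.five_le
  have h := hu.far g hg.nonneg (by have := hg.le; omega) hg.adj
  have := hg.le
  omega

lemma last_gap (hS : Setup G ℓ n δ c x) (hu : Member G ℓ n δ c x u) (hg : IsLast G δ c u g) :
    ArcGap G c x u g δ δ g := by
  have hb := hS.last_bounds hu hg
  have := hS.five_le
  refine ⟨hg.le, Or.inr ⟨rfl, rfl⟩, fun k h1 h2 => ⟨fun h => ?_, fun h => h ▸ hS.adj_end⟩,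
    fun k h1 h2 => ⟨fun h => ?_, fun h => h ▸ hg.adj⟩⟩
  · by_contra hne
    exact hS.nadj k (by omega) (by omega) h
  · by_contra hne
    exact hg.max k (by omega) h2 h

lemma first_le_last (hf : IsFirst G δ c u f) (hg : IsLast G δ c u g) : f ≤ g := by
  by_contra h
  exact hf.min g hg.nonneg (by omega) hg.adj

/-- The neighbours of a member in `[0, δ]` are not just two consecutive vertices. -/
lemma last_ne_first_add_one (hS : Setup G ℓ n δ c x) (hδe : Even δ) (hn : Odd n)
    (hu : Member G ℓ n δ c x u) (hout : ∃ k, δ ≤ k ∧ k ≤ n ∧ G.Adj u (c k))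
    (hf : IsFirst G δ c u f) (hg : IsLast G δ c u g) : g ≠ f + 1 := by
  intro hfg
  have hδ := hS.delta_le
  have hδ' := hS.le_delta
  have hℓ := hS.five_le
  have hbf := hS.first_bounds hu hf
  have hbg := hS.last_bounds hu hg
  have hα := hS.first_gap hu hf
  have hβ := hS.last_gap hu hg
  obtain ⟨g₂, a1, a2, a3, a4⟩ := exists_least hout
  obtain ⟨g₁, b1, b2, b3, b4⟩ := exists_greatest hout
  have h12 : g₂ ≤ g₁ := by
    by_contra h
    exact b4 g₂ (by omega) a2 a3
  have p₁ := hu.far g₁ (by omega) (by omega) b3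
  have p₂ := hu.far g₂ (by omega) (by omega) a3
  have hxn : G.Adj x (c n) := by
    have := hS.cyc.per 0
    rw [zero_add] at this
    rw [this]
    exact hS.adj_zero
  obtain ⟨z₁, d1, d2, d3, d4⟩ := exists_least (P := fun k => G.Adj x (c k)) ⟨n, b2, le_rfl, hxn⟩
  obtain ⟨z₂, e1, e2, e3, e4⟩ := exists_greatest (P := fun k => G.Adj x (c k))
    ⟨δ, le_rfl, a1, hS.adj_end⟩
  have hP₁ : ArcGap G c x u g₁ z₁ z₁ g₁ := ⟨d1, Or.inr ⟨rfl, rfl⟩, fun k h4 h5 => ⟨fun h => by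
    by_contra hne; exact d4 k h4 (by omega) h, fun h => h ▸ d3⟩, fun k h4 h5 => ⟨fun h => by
    by_contra hne; exact b4 k (by omega) (by omega) h, fun h => h ▸ b3⟩⟩
  have hP₂ : ArcGap G c x u z₂ g₂ z₂ g₂ := ⟨e2, Or.inl ⟨rfl, rfl⟩, fun k h4 h5 => ⟨fun h => by
    by_contra hne; exact e4 k (by omega) h5 h, fun h => h ▸ e3⟩, fun k h4 h5 => ⟨fun h => by
    by_contra hne; exact a4 k (by omega) (by omega) h, fun h => h ▸ a3⟩⟩
  -- As `δ` is even and `g = f + 1`, the arcs `[0, f]` and `[g, δ]` have opposite parity. The outer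
  -- gap `[g₁, z₁]` has the parity of `[g, δ]`, and `[z₂, g₂]` that of `[0, f]`.
  have w₁ := hS.even.two_gaps hS.cyc hβ hP₁ (Or.inl ⟨by omega, by omega⟩) hS.off hu.off hu.ne
    hu.nadj (by omega) (by omega)
  have w₂ := hS.even.two_gaps hS.cyc hα hP₂ (Or.inl ⟨by omega, by omega⟩) hS.off hu.off hu.ne
    hu.nadj (by omega) (by omega)
  rw [Int.even_iff] at hδe w₁ w₂
  rw [Int.odd_iff] at hn
  -- Otherwise `[g₁, z₁]` is also apart from `[0, f]` and would have both parities. The bounds on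
  -- `z₂` and on `g₁` below come from similar comparisons.
  have hz₁ : n - 1 ≤ z₁ := by
    by_contra h
    have := hS.even.two_gaps hS.cyc hα hP₁ (Or.inl ⟨by omega, by omega⟩) hS.off hu.off hu.ne
      hu.nadj (by omega) (by omega)
    rw [Int.even_iff] at this
    omega
  have hz₂ : z₂ ≤ δ + 1 := by
    by_contra h
    have := hS.even.two_gaps hS.cyc hβ hP₂ (Or.inl ⟨by omega, by omega⟩) hS.off hu.off hu.ne
      hu.nadj (by omega) (by omega)
    rw [Int.even_iff] at this
    omega
  have h21 : g₁ ≤ g₂ + 1 := by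
    by_contra h
    have := hS.even.two_gaps hS.cyc hP₂ hP₁ (Or.inl ⟨by omega, by omega⟩) hS.off hu.off hu.ne
      hu.nadj (by omega) (by omega)
    rw [Int.even_iff] at this
    omega
  rcases eq_or_lt_of_le h12 with rfl | hlt
  -- With one outer neighbour of `u`, `x` has only the ends of `[z₂, z₁]` as neighbours there, yet
  -- this arc is a union of two gaps of opposite parity, so it is odd.
  · have := hS.even.spanned hS.cyc hS.off e3 d3 (fun k h1 h2 h => by
      by_cases h3 : k ≤ g₂
      · exact e4 k h1 h3 h
      · exact d4 k (by omega) h2 h) (by omega) (by omega) (by omega)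
    rw [Int.even_iff] at this
    omega
  -- Now the neighbours of `u` are two pairs of consecutive vertices. The two arcs between the pairs
  -- are even, and together with the two edges inside the pairs they make up the odd length `n`.
  · have s₁ := hS.even.spanned hS.cyc hu.off hg.adj a3 (fun k h1 h2 h => by
      by_cases h3 : k ≤ δ
      · exact hg.max k h1 h3 h
      · exact a4 k (by omega) h2 h) (by omega) (by omega) (by omega)
    have s₂ := hS.even.spanned hS.cyc hu.off b3 (j := f + n) (by rw [hS.cyc.per]; exact hf.adj)
      (fun k h1 h2 h => by
        by_cases h3 : k ≤ n
        · exact b4 k h1 h3 h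
        · have := hS.cyc.per (k - n)
          rw [sub_add_cancel] at this
          rw [this] at h
          exact hf.min (k - n) (by omega) (by omega) h) (by omega) (by omega) (by omega)
    rw [Int.even_iff] at s₁ s₂
    omega

/-- When `f = g` this is the evenness of `δ`; otherwise `f + 2 ≤ g`, and the first and last gaps
close up to a hole. -/
lemma even_first_iff (hS : Setup G ℓ n δ c x) (hδe : Even δ) (hn : Odd n)
    (hu : Member G ℓ n δ c x u) (hout : ∃ k, δ ≤ k ∧ k ≤ n ∧ G.Adj u (c k))
    (hf : IsFirst G δ c u f) (hg : IsLast G δ c u g) : Even f ↔ Even (δ - g) := by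
  have hne := hS.last_ne_first_add_one hδe hn hu hout hf hg
  have hle := first_le_last hf hg
  have hδ := hS.delta_le
  have hℓ := hS.five_le
  have hbf := hS.first_bounds hu hf
  have hbg := hS.last_bounds hu hg
  rw [Int.even_iff] at hδe
  rw [Int.even_iff, Int.even_iff]
  rcases eq_or_lt_of_le hle with rfl | hlt
  · omega
  · have := hS.even.two_gaps hS.cyc (hS.first_gap hu hf) (hS.last_gap hu hg)
      (Or.inl ⟨by omega, by omega⟩) hS.off hu.off hu.ne hu.nadj (by omega) (by omega)
    rw [Int.even_iff] at this
    omega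

/-- All gaps between `x` and a member have the same parity. -/
lemma even_gap_iff (hS : Setup G ℓ n δ c x) (hδe : Even δ) (hn : Odd n)
    (hu : Member G ℓ n δ c x u) (hout : ∃ k, δ ≤ k ∧ k ≤ n ∧ G.Adj u (c k))
    (hf : IsFirst G δ c u f) {i j a b : ℤ} (hI : ArcGap G c x u i j a b) (hi : 0 ≤ i) (hi' : i < n)
    (hj : j < i + n) : Even (j - i) ↔ Even f := by
  obtain ⟨g, hg⟩ := hu.exists_isLast
  have hfg := hS.even_first_iff hδe hn hu hout hf hg
  have hδ := hS.delta_le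
  have hδ' := hS.le_delta
  have hℓ := hS.five_le
  have hbf := hS.first_bounds hu hf
  have hbg := hS.last_bounds hu hg
  have hle := hI.le
  have hends := hI.ends
  have hxn : G.Adj x (c n) := by
    have := hS.cyc.per 0
    rw [zero_add] at this
    rw [this]
    exact hS.adj_zero
  have x0 : i ≤ 0 → 0 = a := fun h => (hI.left 0 h (by omega)).1 hS.adj_zero
  have xδ : i ≤ δ → δ ≤ j → δ = a := fun h h' => (hI.left δ h h').1 hS.adj_end
  have xn : n ≤ j → n = a := fun h' => (hI.left n (by omega) h').1 hxn
  have ha := hI.adj_left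
  have hb := hI.adj_right
  have hbn : b ≤ n := by
    by_contra h
    have := xn (by omega)
    omega
  have hfar := hu.far b (by omega) hbn hb
  have hxa : ¬ (0 < a ∧ a < δ) := fun h => hS.nadj a h.1 h.2 ha
  have key : δ ≤ i → j ≤ n → (Even (j - i) ↔ Even f) := by
    intro h1 h2
    by_cases h3 : j + 2 ≤ n
    · have := hS.even.two_gaps hS.cyc (hS.first_gap hu hf) hI (Or.inl ⟨by omega, by omega⟩) hS.off
        hu.off hu.ne hu.nadj (by omega) (by omega)
      rw [Int.even_iff] at this ⊢
      rw [Int.even_iff]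
      omega
    -- A gap ending within one of `n` is too close to `[0, f]`. Its end near `n` is not a neighbour
    -- of `u`, so `i` is, hence `i` is at least `ℓ` beyond `δ` and the last gap can be used instead.
    · have := hS.even.two_gaps hS.cyc (hS.last_gap hu hg) hI (Or.inl ⟨by omega, by omega⟩) hS.off
        hu.off hu.ne hu.nadj (by omega) (by omega)
      rw [Int.even_iff] at this ⊢
      rw [Int.even_iff, Int.even_iff] at hfg
      rw [Int.even_iff]
      omega
  by_cases h1 : δ ≤ i
  · exact key h1 (by
      by_contra h
      have := xn (by omega)
      omega)
  -- A gap starting before `δ` must be `[0, f]` or `[g, δ]`, as `x` has no neighbour strictly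
  -- between 0 and `δ`.
  by_cases h2 : i = 0
  · subst h2
    have h0 := x0 le_rfl
    have hjδ : j < δ := by
      by_contra h
      have := xδ (by omega) (by omega)
      omega
    have hfj : f ≤ b := by
      by_contra h
      exact hf.min b (by omega) (by omega) hb
    have := (hI.right f (by omega) (by omega)).1 hf.adj
    obtain rfl : f = j := by omega
    simp
  · have hjδ : δ ≤ j := by
      by_contra h
      omega
    have h3 := xδ (by omega) hjδ
    have hgb : b ≤ g := by
      by_contra h
      exact hg.max b (by omega) (by omega) hb
    have := (hI.right g (by omega) (by omega)).1 hg.adj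
    obtain rfl : g = i := by omega
    obtain rfl : δ = j := by omega
    exact hfg.symm

theorem family (hS : Setup G ℓ n δ c x) (hδe : Even δ) (hn : Odd n) {p : Prop}
    (hM : ∀ u ∈ M, Member G ℓ n δ c x u) (hout : ∀ u ∈ M, ∃ k, δ ≤ k ∧ k ≤ n ∧ G.Adj u (c k))
    (hpar : ∀ u ∈ M, ∃ i j a b, 0 ≤ i ∧ i < n ∧ j < i + n ∧ ArcGap G c x u i j a b ∧
      (Even (j - i) ↔ p)) : Family G ℓ n δ c x M p := by
  have hδ' := hS.le_delta
  have hδ := hS.delta_le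
  have hfirst : ∀ u ∈ M, ∀ f, IsFirst G δ c u f → (Even f ↔ p) := by
    intro u hu f hf
    obtain ⟨i, j, a, b, h1, h2, h3, h4, h5⟩ := hpar u hu
    rw [← h5]
    exact (hS.even_gap_iff hδe hn (hM u hu) (hout u hu) hf h4 h1 h2 h3).symm
  refine ⟨hM, ?_, hfirst, ?_⟩
  · intro u hu f hf
    obtain ⟨g, hg⟩ := (hM u hu).exists_isLast
    have h1 := hS.last_ne_first_add_one hδe hn (hM u hu) (hout u hu) hf hg
    have h2 := first_le_last hf hg
    by_cases h3 : g = f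
    · subst h3
      refine Or.inl fun k h4 h5 h6 => ?_
      by_contra h7
      rcases lt_or_gt_of_ne h7 with h8 | h8
      · exact hf.min k h4 h8 h6
      · exact hg.max k h8 h5 h6
    · exact Or.inr ⟨g, by omega, hg.le, hg.adj⟩
  · intro u hu i j a b hI h1 h2
    obtain ⟨f, hf⟩ := (hM u hu).exists_isFirst
    have := hI.le
    rw [hS.even_gap_iff hδe hn (hM u hu) (hout u hu) hf hI (by omega) (by omega) (by omega)]
    exact hfirst u hu f hf

end Setup

end LongOddHole

/-! ### From closed walks and their paths to periodic sequences and arcs. -/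

namespace LongOddHole

open SimpleGraph

variable {V : Type*} {G : SimpleGraph V}

/-- `c` winds around the closed walk `C` of length `n` periodically, without repeating vertices
within a period. -/
structure Winds {c₀ : V} (C : G.Walk c₀ c₀) (n : ℤ) (c : ℤ → V) : Prop where
  len : n = C.length
  supp : ∀ v, v ∈ C.support ↔ ∃ k, c k = v
  edges : ∀ v w, s(v, w) ∈ C.edges ↔ ∃ k, s(c k, c (k + 1)) = s(v, w)
  per : ∀ i, c (i + n) = c i
  ne : ∀ i j, i < j → j < i + n → c i ≠ c j

/-- `P` traverses the arc `[i, j]` of the cycle `c`, in one of the two directions. -/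
structure IsArc (n : ℤ) (c : ℤ → V) {a b : V} (P : G.Walk a b) (i j : ℤ) : Prop where
  le : i ≤ j
  lt : j < i + n
  ends : (a = c i ∧ b = c j) ∨ (a = c j ∧ b = c i)
  supp : ∀ w, w ∈ P.support ↔ ∃ k, i ≤ k ∧ k ≤ j ∧ c k = w
  edges : ∀ v w, s(v, w) ∈ P.edges ↔ ∃ k, i ≤ k ∧ k < j ∧ s(c k, c (k + 1)) = s(v, w)
  length : (P.length : ℤ) = j - i

variable {c₀ : V} {C : G.Walk c₀ c₀} {n : ℤ} {c : ℤ → V}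

lemma exists_winds (hC : C.IsCycle) : ∃ c, Winds C C.length c := by
  have h3 := hC.three_le_length
  set n : ℤ := (C.length : ℤ) with hn
  have hn0 : 0 < n := by omega
  let c : ℤ → V := fun i => C.getVert (i % n).toNat
  have hlt : ∀ k : ℤ, 0 ≤ k % n ∧ k % n < n := fun k =>
    ⟨Int.emod_nonneg _ hn0.ne', Int.emod_lt_of_pos _ hn0⟩
  have hc : ∀ k : ℕ, k < C.length → c k = C.getVert k := by
    intro k hk
    change C.getVert ((k : ℤ) % n).toNat = _
    rw [Int.emod_eq_of_lt (by omega) (by omega)]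
    simp
  have hsucc : ∀ k, c (k + 1) = C.getVert ((k % n).toNat + 1) := by
    intro k
    have h1 := hlt k
    change C.getVert ((k + 1) % n).toNat = _
    by_cases h : k % n + 1 < n
    · have : (k + 1) % n = k % n + 1 := by
        rw [← Int.emod_add_emod, Int.emod_eq_of_lt (by omega) h]
      rw [this]
      congr 1
      omega
    · have h2 : k % n + 1 = n := by omega
      have : (k + 1) % n = 0 := by
        rw [← Int.emod_add_emod, h2, Int.emod_self]
      rw [this, show (k % n).toNat + 1 = C.length by omega, Walk.getVert_length]
      simp
  refine ⟨c, rfl, fun v => ?_, fun v w => ?_, fun i => ?_, fun i j h1 h2 h => ?_⟩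
  · rw [Walk.mem_support_iff_exists_getVert]
    constructor
    · rintro ⟨k, rfl, hk⟩
      rcases eq_or_lt_of_le hk with rfl | hk
      · refine ⟨(0 : ℕ), ?_⟩
        rw [hc 0 (by omega)]
        simp
      · exact ⟨k, hc k hk⟩
    · rintro ⟨k, rfl⟩
      exact ⟨_, rfl, by have := hlt k; omega⟩
  · rw [Walk.mk_mem_edges_iff_exists]
    constructor
    · rintro ⟨k, hk, h⟩
      refine ⟨k, ?_⟩
      rw [hsucc, hc k hk, ← h, Int.emod_eq_of_lt (by omega) (by omega)]
      simp
    · rintro ⟨k, h⟩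
      refine ⟨(k % n).toNat, by have := hlt k; omega, ?_⟩
      rw [← h, hsucc]
  · change C.getVert ((i + n) % n).toNat = C.getVert (i % n).toNat
    rw [Int.add_emod_right]
  · have hi := hlt i
    have hj := hlt j
    have := hC.getVert_injOn' (show (i % n).toNat ≤ C.length - 1 by omega)
      (show (j % n).toNat ≤ C.length - 1 by omega) h
    have h4 : i % n = j % n := by omega
    have h5 : n ∣ j - i := Int.dvd_of_emod_eq_zero (Int.emod_eq_emod_iff_emod_sub_eq_zero.1 h4.symm)
    have := Int.le_of_dvd (by omega) h5
    omega

namespace Winds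

variable (hW : Winds C n c)
include hW

lemma shift (σ : ℤ) : Winds C n (fun i => c (σ + i)) := by
  refine ⟨hW.len, fun v => ?_, fun v w => ?_, fun i => ?_, fun i j h1 h2 => ?_⟩
  · rw [hW.supp]
    exact ⟨fun ⟨k, hk⟩ => ⟨k - σ, by simpa using hk⟩, fun ⟨k, hk⟩ => ⟨σ + k, hk⟩⟩
  · rw [hW.edges]
    constructor
    · rintro ⟨k, hk⟩
      refine ⟨k - σ, ?_⟩
      rw [← hk, add_sub_cancel, show σ + (k - σ + 1) = k + 1 by ring]
    · rintro ⟨k, hk⟩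
      refine ⟨σ + k, ?_⟩
      rw [← hk, add_assoc]
  · have := hW.per (σ + i)
    rwa [add_assoc] at this
  · exact hW.ne _ _ (by omega) (by omega)

lemma inj {m i j : ℤ} (hi : m ≤ i) (hi' : i < m + n) (hj : m ≤ j) (hj' : j < m + n)
    (h : c i = c j) : i = j := by
  by_contra hne
  rcases lt_or_gt_of_ne hne with h1 | h1
  · exact hW.ne i j h1 (by omega) h
  · exact hW.ne j i h1 (by omega) h.symm

/-- Every index can be moved into a chosen period; agreement for all `r` lets whole arcs move with
it. -/
lemma normalize (hn : 0 < n) (m k : ℤ) :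
    ∃ k', m ≤ k' ∧ k' < m + n ∧ ∀ r, c (k' + r) = c (k + r) := by
  have hper : ∀ (q : ℕ) i, c (i + q * n) = c i := by
    intro q
    induction q with
    | zero => simp
    | succ q ih =>
      intro i
      have := hW.per (i + q * n)
      rw [ih] at this
      rw [← this]
      congr 1
      push_cast
      ring
  have hper' : ∀ (q : ℤ) i, c (i + q * n) = c i := by
    intro q i
    obtain ⟨q, rfl | rfl⟩ := q.eq_nat_or_neg
    · exact hper q i
    · have := hper q (i + -q * n)
      rw [← this]
      congr 1
      ring
  have h1 := Int.emod_nonneg (k - m) hn.ne'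
  have h2 := Int.emod_lt_of_pos (k - m) hn
  refine ⟨m + (k - m) % n, by omega, by omega, fun r => ?_⟩
  rw [← hper' ((k - m) / n) (m + (k - m) % n + r)]
  congr 1
  have := Int.emod_add_mul_ediv (k - m) n
  linarith [mul_comm n ((k - m) / n)]

lemma mem_support (k : ℤ) : c k ∈ C.support := (hW.supp _).2 ⟨k, rfl⟩

lemma mem_edges (k : ℤ) : s(c k, c (k + 1)) ∈ C.edges := (hW.edges _ _).2 ⟨k, rfl⟩

lemma adj_succ (k : ℤ) : G.Adj (c k) (c (k + 1)) := C.adj_of_mem_edges (hW.mem_edges k)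

lemma eq_or_eq_of_mem_edges (hn : 0 < n) {m : ℤ} {v : V} (h : s(v, c m) ∈ C.edges) :
    v = c (m - 1) ∨ v = c (m + 1) := by
  obtain ⟨k, hk⟩ := (hW.edges _ _).1 h
  obtain ⟨k', h1, h2, h3⟩ := hW.normalize hn m k
  have h30 := h3 0
  have h31 := h3 1
  simp only [add_zero] at h30
  rw [← h30, ← h31, Sym2.eq_iff] at hk
  rcases hk with ⟨hk, hk'⟩ | ⟨hk, hk'⟩
  · left
    rw [← hk]
    rcases eq_or_lt_of_le (show k' + 1 ≤ m + n by omega) with h | h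
    · have := hW.per (m - 1)
      rw [← this]
      congr 1
      omega
    · exact absurd hk'.symm (hW.ne m (k' + 1) (by omega) h)
  · right
    rw [← hk']
    rcases eq_or_lt_of_le h1 with rfl | h
    · rfl
    · exact absurd hk.symm (hW.ne m k' h h2)

lemma cycleMap (hn : 4 ≤ n) (hC : C.IsChordless) : CycleMap G n c := by
  refine ⟨hn, hW.per, hW.ne, fun i j h1 h2 => ⟨fun h => ?_, ?_⟩⟩
  · rcases hW.eq_or_eq_of_mem_edges (by omega)
      (hC.mem_edges (hW.mem_support j) (hW.mem_support i) h.symm) with h3 | h3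
    · right
      have := hW.per (i - 1)
      rw [← this] at h3
      have := hW.inj (m := i) (by omega) (by omega) (by omega) (by omega) h3
      omega
    · left
      exact hW.inj (m := i) (by omega) (by omega) (by omega) (by omega) h3
  · rintro (rfl | h)
    · exact hW.adj_succ i
    · have h3 := hW.per i
      rw [← h] at h3
      rw [← h3]
      exact (hW.adj_succ j).symm

/-- Every path of `C` traverses an arc. -/
lemma exists_isArc (hn : 3 ≤ n) {a b : V} (P : G.Walk a b) (hP : IsPathOf C P) :
    ∃ i j, IsArc n c P i j := by
  induction P with
  | nil =>
    obtain ⟨h1, h2, h3⟩ := hP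
    obtain ⟨k, hk⟩ := (hW.supp _).1 (h2 (Walk.start_mem_support _))
    refine ⟨k, k, le_rfl, by omega, Or.inl ⟨hk.symm, hk.symm⟩, fun w => ?_, fun v w => ?_, by simp⟩
    · simp only [Walk.support_nil, List.mem_singleton]
      constructor
      · rintro rfl
        exact ⟨k, le_rfl, le_rfl, hk⟩
      · rintro ⟨k', h4, h5, rfl⟩
        rw [← hk]
        congr 1
        omega
    · simp only [Walk.edges_nil, List.not_mem_nil, false_iff]
      rintro ⟨k', h4, h5, -⟩
      omega
  | @cons u v w h p ih =>
    obtain ⟨h1, h2, h3⟩ := hP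
    rw [Walk.cons_isPath_iff] at h1
    rw [Walk.support_cons, List.cons_subset] at h2
    rw [Walk.edges_cons, List.cons_subset] at h3
    obtain ⟨i, j, hA⟩ := ih ⟨h1.1, h2.2, h3.2⟩
    have hle := hA.le
    have hlt := hA.lt
    have hlen := hA.length
    have hu : ∀ k, i ≤ k → k ≤ j → u ≠ c k := fun k h4 h5 h6 =>
      h1.2 ((hA.supp u).2 ⟨k, h4, h5, h6.symm⟩)
    have fwd : v = c j → w = c i → u = c (j + 1) → ∃ i j, IsArc n c (Walk.cons h p) i j := by
      intro hv hw hu'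
      refine ⟨i, j + 1, by omega, ?_, Or.inr ⟨hu', hw⟩, fun y => ?_, fun y z => ?_, ?_⟩
      · by_contra h4
        apply hu i le_rfl hle
        rw [hu', ← hW.per i]
        congr 1
        omega
      · rw [Walk.support_cons, List.mem_cons, hA.supp]
        constructor
        · rintro (rfl | ⟨k, h4, h5, h6⟩)
          · exact ⟨j + 1, by omega, le_rfl, hu'.symm⟩
          · exact ⟨k, h4, by omega, h6⟩
        · rintro ⟨k, h4, h5, rfl⟩
          rcases eq_or_lt_of_le h5 with rfl | h5
          · exact Or.inl hu'.symm
          · exact Or.inr ⟨k, h4, by omega, rfl⟩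
      · rw [Walk.edges_cons, List.mem_cons, hA.edges]
        constructor
        · rintro (h4 | ⟨k, h4, h5, h6⟩)
          · refine ⟨j, hle, by omega, ?_⟩
            rw [h4, hu', hv, Sym2.eq_swap]
          · exact ⟨k, h4, by omega, h6⟩
        · rintro ⟨k, h4, h5, h6⟩
          rcases eq_or_lt_of_le (show k ≤ j by omega) with rfl | h5
          · left
            rw [← h6, hu', hv, Sym2.eq_swap]
          · exact Or.inr ⟨k, h4, h5, h6⟩
      · rw [Walk.length_cons]
        push_cast
        omega
    have bwd : v = c i → w = c j → u = c (i - 1) → ∃ i j, IsArc n c (Walk.cons h p) i j := by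
      intro hv hw hu'
      refine ⟨i - 1, j, by omega, ?_, Or.inl ⟨hu', hw⟩, fun y => ?_, fun y z => ?_, ?_⟩
      · by_contra h4
        apply hu j hle le_rfl
        rw [hu', ← hW.per (i - 1)]
        congr 1
        omega
      · rw [Walk.support_cons, List.mem_cons, hA.supp]
        constructor
        · rintro (rfl | ⟨k, h4, h5, h6⟩)
          · exact ⟨i - 1, le_rfl, by omega, hu'.symm⟩
          · exact ⟨k, by omega, by omega, h6⟩
        · rintro ⟨k, h4, h5, rfl⟩
          rcases eq_or_lt_of_le h4 with rfl | h4
          · exact Or.inl hu'.symm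
          · exact Or.inr ⟨k, by omega, by omega, rfl⟩
      · rw [Walk.edges_cons, List.mem_cons, hA.edges]
        constructor
        · rintro (h4 | ⟨k, h4, h5, h6⟩)
          · refine ⟨i - 1, by omega, by omega, ?_⟩
            rw [h4, hu', hv, sub_add_cancel]
          · exact ⟨k, by omega, by omega, h6⟩
        · rintro ⟨k, h4, h5, h6⟩
          rcases eq_or_lt_of_le h4 with rfl | h4
          · left
            rw [← h6, hu', hv, sub_add_cancel]
          · exact Or.inr ⟨k, by omega, h5, h6⟩
      · rw [Walk.length_cons]
        push_cast
        omega
    have hedge := h3.1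
    rcases hA.ends with ⟨hv, hw⟩ | ⟨hv, hw⟩
    · rw [hv] at hedge
      rcases hW.eq_or_eq_of_mem_edges (by omega) hedge with h4 | h4
      · exact bwd hv hw h4
      -- A one-vertex arc can be extended in either direction; a longer one would meet its second
      -- vertex again.
      · rcases eq_or_lt_of_le hle with rfl | h5
        · exact fwd hv hw h4
        · exact absurd h4 (hu (i + 1) (by omega) (by omega))
    · rw [hv] at hedge
      rcases hW.eq_or_eq_of_mem_edges (by omega) hedge with h4 | h4
      · rcases eq_or_lt_of_le hle with rfl | h5
        · exact bwd hv hw h4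
        · exact absurd h4 (hu (j - 1) (by omega) (by omega))
      · exact fwd hv hw h4

omit hW in
lemma _root_.LongOddHole.IsArc.translate {a b : V} {P : G.Walk a b} {i j i' : ℤ}
    (hA : IsArc n c P i j) (h : ∀ r, c (i' + r) = c (i + r)) :
    IsArc n c P i' (i' + (j - i)) := by
  have hle := hA.le
  have hlt := hA.lt
  have e1 : ∀ k, c (k - i + i') = c k := fun k => by
    rw [add_comm, h]
    congr 1
    ring
  have e2 : ∀ k, c (k - i' + i) = c k := fun k => by
    rw [add_comm, ← h]
    congr 1
    ring
  have ei : c i' = c i := by simpa using h 0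
  refine ⟨by omega, by omega, ?_, fun w => ?_, fun v w => ?_, by rw [hA.length]; ring⟩
  · rw [ei, h (j - i), add_sub_cancel]
    exact hA.ends
  · rw [hA.supp]
    constructor
    · rintro ⟨k, h1, h2, rfl⟩
      exact ⟨k - i + i', by omega, by omega, e1 k⟩
    · rintro ⟨k, h1, h2, rfl⟩
      exact ⟨k - i' + i, by omega, by omega, e2 k⟩
  · rw [hA.edges]
    constructor
    · rintro ⟨k, h1, h2, h3⟩
      refine ⟨k - i + i', by omega, by omega, ?_⟩
      rw [← h3, e1, ← e1 (k + 1), show k - i + i' + 1 = k + 1 - i + i' by ring]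
    · rintro ⟨k, h1, h2, h3⟩
      refine ⟨k - i' + i, by omega, by omega, ?_⟩
      rw [← h3, e2, ← e2 (k + 1), show k - i' + i + 1 = k + 1 - i' + i by ring]

lemma exists_isArc_from (hn : 3 ≤ n) {a b : V} (P : G.Walk a b) (hP : IsPathOf C P) (m : ℤ) :
    ∃ i j, m ≤ i ∧ i < m + n ∧ IsArc n c P i j := by
  obtain ⟨i, j, hA⟩ := hW.exists_isArc hn P hP
  obtain ⟨i', h1, h2, h3⟩ := hW.normalize (by omega) m i
  exact ⟨i', _, h1, h2, hA.translate h3⟩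

/-- Every arc is traversed by a path of `C`. -/
lemma exists_walk {i j : ℤ} (hij : i ≤ j) (hj : j < i + n) :
    ∃ P : G.Walk (c i) (c j), IsPathOf C P ∧ IsArc n c P i j := by
  induction j, hij using Int.leInduction with
  | base =>
    refine ⟨Walk.nil, ⟨Walk.IsPath.nil, ?_, by simp⟩, le_rfl, hj, Or.inl ⟨rfl, rfl⟩, fun w => ?_,
      fun v w => ?_, by simp⟩
    · simpa using hW.mem_support i
    · simp only [Walk.support_nil, List.mem_singleton]
      constructor
      · rintro rfl
        exact ⟨i, le_rfl, le_rfl, rfl⟩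
      · rintro ⟨k, h1, h2, rfl⟩
        congr 1
        omega
    · simp only [Walk.edges_nil, List.not_mem_nil, false_iff]
      rintro ⟨k', h4, h5, -⟩
      omega
  | succ j hij ih =>
    obtain ⟨P, ⟨p1, p2, p3⟩, hA⟩ := ih (by omega)
    have hlen := hA.length
    refine ⟨P.concat (hW.adj_succ j), ⟨p1.concat ?_ _, ?_, ?_⟩, by omega, hj, Or.inl ⟨rfl, rfl⟩,
      fun w => ?_, fun v w => ?_, ?_⟩
    · rw [hA.supp]
      rintro ⟨k, h1, h2, h3⟩
      exact hW.ne k (j + 1) (by omega) (by omega) h3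
    · rw [Walk.support_concat, List.append_subset]
      exact ⟨p2, by simpa using hW.mem_support (j + 1)⟩
    · rw [Walk.edges_concat, List.concat_eq_append, List.append_subset]
      exact ⟨p3, by simpa using hW.mem_edges j⟩
    · rw [Walk.support_concat, List.mem_append, hA.supp, List.mem_singleton]
      constructor
      · rintro (⟨k, h4, h5, h6⟩ | rfl)
        · exact ⟨k, h4, by omega, h6⟩
        · exact ⟨j + 1, by omega, le_rfl, rfl⟩
      · rintro ⟨k, h4, h5, rfl⟩
        rcases eq_or_lt_of_le h5 with rfl | h5
        · exact Or.inr rfl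
        · exact Or.inl ⟨k, h4, by omega, rfl⟩
    · rw [Walk.edges_concat, List.concat_eq_append, List.mem_append, hA.edges, List.mem_singleton]
      constructor
      · rintro (⟨k, h4, h5, h6⟩ | h4)
        · exact ⟨k, h4, by omega, h6⟩
        · exact ⟨j, hij, by omega, h4.symm⟩
      · rintro ⟨k, h4, h5, h6⟩
        rcases eq_or_lt_of_le (show k ≤ j by omega) with rfl | h5
        · exact Or.inr h6.symm
        · exact Or.inl ⟨k, h4, h5, h6⟩
    · rw [Walk.length_concat]
      push_cast
      omega

end Winds

end LongOddHole

/-! ### Gaps, major vertices and cost in terms of arcs. -/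

namespace LongOddHole

open SimpleGraph

variable {V : Type*} {G : SimpleGraph V} {c₀ : V} {C : G.Walk c₀ c₀} {n : ℤ} {c : ℤ → V}

/-- In an induced path from `u` whose interior is an arc, the second vertex is an end of the arc and
the only neighbour of `u` in it. -/
lemma exists_end_of_interior {H : SimpleGraph V} {u v : V} (R : H.Walk u v) (hR : IsInducedPath R)
    (huv : u ≠ v) (hnadj : ¬ H.Adj u v) {i j : ℤ} (hne : ∀ k, i < k → k < j → c (k - 1) ≠ c (k + 1))
    (hint : ∀ w, (w ∈ R.support ∧ w ≠ u ∧ w ≠ v) ↔ ∃ k, i ≤ k ∧ k ≤ j ∧ c k = w)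
    (hadj : ∀ k, i ≤ k → k < j → H.Adj (c k) (c (k + 1))) :
    ∃ a, (a = i ∨ a = j) ∧ H.Adj u (c a) ∧ (∀ k, i ≤ k → k ≤ j → H.Adj u (c k) → c k = c a) ∧
      ∀ y ∈ R.support, y ≠ u → H.Adj (c a) y → y = R.getVert 2 := by
  cases R with
  | nil => exact absurd rfl huv
  | @cons _ w _ h p =>
    have hp := (Walk.cons_isPath_iff _ _).1 hR.1
    have hwv : w ≠ v := fun e => hnadj (e ▸ h)
    obtain ⟨a, h1, h2, rfl⟩ := (hint w).1 ⟨by simp, h.ne', hwv⟩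
    have hsnd : ∀ y ∈ (Walk.cons h p).support, y ≠ u → H.Adj (c a) y →
        y = (Walk.cons h p).getVert 2 := by
      intro y hy hyu hay
      have := hR.2.mem_edges (by simp) hy hay
      rw [Walk.edges_cons, List.mem_cons] at this
      rcases this with h3 | h3
      · rw [Sym2.eq_iff] at h3
        rcases h3 with ⟨h3, -⟩ | ⟨-, h3⟩
        · exact absurd h3 h.ne'
        · exact absurd h3 hyu
      · rw [hp.1.eq_snd_of_mem_edges h3]
        rfl
    refine ⟨a, ?_, h, fun k h3 h4 h5 => ?_, hsnd⟩
    · by_contra hcon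
      have m₁ := (hint (c (a - 1))).2 ⟨a - 1, by omega, by omega, rfl⟩
      have m₂ := (hint (c (a + 1))).2 ⟨a + 1, by omega, by omega, rfl⟩
      have a₁ := hadj (a - 1) (by omega) (by omega)
      rw [sub_add_cancel] at a₁
      -- Both neighbours of `c a` along the arc would be the third vertex of the induced path.
      exact hne a (by omega) (by omega) ((hsnd _ m₁.1 m₁.2.1 a₁.symm).trans
        (hsnd _ m₂.1 m₂.2.1 (hadj a h1 (by omega))).symm)
    · have m := (hint (c k)).2 ⟨k, h3, h4, rfl⟩
      have h6 := hR.1.eq_snd_of_mem_edges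
        (hR.2.mem_edges (Walk.start_mem_support _) m.1 h5)
      simpa using h6

/-- Deleting the edge `uv` affects no adjacency with a vertex of the arc, so the end analysis can be
done in the smaller graph, from both ends of the induced path. -/
lemma IsGap.exists_arcGap {u v a b : V} {P : G.Walk a b} (hg : IsGap C u v P) (hW : Winds C n c)
    (hn : 4 ≤ n) {i j : ℤ} (hA : IsArc n c P i j) : ∃ a b, ArcGap G c u v i j a b := by
  obtain ⟨huv, -, R, hR, hint⟩ := hg
  have hle := hA.le
  have hlt := hA.lt
  have hint' : ∀ w, (w ∈ R.support ∧ w ≠ u ∧ w ≠ v) ↔ ∃ k, i ≤ k ∧ k ≤ j ∧ c k = w := by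
    intro w
    rw [← hA.supp w]
    exact Set.ext_iff.1 hint w
  have hoff : ∀ k, i ≤ k → k ≤ j → c k ≠ u ∧ c k ≠ v := fun k h1 h2 =>
    ((hint' (c k)).2 ⟨k, h1, h2, rfl⟩).2
  have hnadj : ¬ (G.deleteEdges {s(u, v)}).Adj u v := by simp [deleteEdges_adj]
  have hiff : ∀ {y z : V}, y ≠ u ∧ y ≠ v → ((G.deleteEdges {s(u, v)}).Adj z y ↔ G.Adj z y) := by
    intro y z hy
    rw [deleteEdges_adj, Set.mem_singleton_iff, Sym2.eq_iff]
    refine and_iff_left_iff_imp.2 fun _ h => ?_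
    rcases h with ⟨-, h⟩ | ⟨-, h⟩
    · exact hy.2 h
    · exact hy.1 h
  have hadj : ∀ k, i ≤ k → k < j → (G.deleteEdges {s(u, v)}).Adj (c k) (c (k + 1)) :=
    fun k h1 h2 => (hiff (hoff (k + 1) (by omega) (by omega))).2 (hW.adj_succ k)
  have hne : ∀ k, i < k → k < j → c (k - 1) ≠ c (k + 1) := fun k h1 h2 =>
    hW.ne _ _ (by omega) (by omega)
  obtain ⟨e, he, he1, he2, he3⟩ := exists_end_of_interior R hR huv hnadj hne hint' hadj
  have hR' : IsInducedPath R.reverse := by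
    refine ⟨hR.1.reverse, ?_⟩
    have h2 := hR.2
    rw [Walk.isChordless_iff_forall_mem_edges] at h2 ⊢
    simpa using h2
  obtain ⟨f, hf, hf1, hf2, -⟩ := exists_end_of_interior R.reverse hR' huv.symm
    (fun h => hnadj h.symm) hne (fun w => by rw [← hint' w]; simp [and_comm]) hadj
  have heb : i ≤ e ∧ e ≤ j := by omega
  have hfb : i ≤ f ∧ f ≤ j := by omega
  refine ⟨e, f, hle, ?_, fun k h1 h2 => ⟨fun h => ?_, ?_⟩, fun k h1 h2 => ⟨fun h => ?_, ?_⟩⟩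
  -- If `u` and `v` attach at the same vertex of an arc with at least two vertices, the third vertex
  -- of the path is both `v` and a vertex of the arc.
  · by_contra hcon
    have hef : e = f := by omega
    subst hef
    have h1 := he3 v R.end_mem_support huv.symm hf1.symm
    rcases he with rfl | rfl
    · have m := (hint' (c (e + 1))).2 ⟨e + 1, by omega, by omega, rfl⟩
      exact m.2.2 ((he3 _ m.1 m.2.1 (hadj e le_rfl (by omega))).trans h1.symm)
    · have m := (hint' (c (e - 1))).2 ⟨e - 1, by omega, by omega, rfl⟩
      have a₁ := hadj (e - 1) (by omega) (by omega)
      rw [sub_add_cancel] at a₁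
      exact m.2.2 ((he3 _ m.1 m.2.1 a₁.symm).trans h1.symm)
  · exact hW.inj (m := i) h1 (by omega) heb.1 (by omega)
      (he2 k h1 h2 ((hiff (hoff k h1 h2)).2 h))
  · rintro rfl
    exact (hiff (hoff _ h1 h2)).1 he1
  · exact hW.inj (m := i) h1 (by omega) hfb.1 (by omega)
      (hf2 k h1 h2 ((hiff (hoff k h1 h2)).2 h))
  · rintro rfl
    exact (hiff (hoff _ h1 h2)).1 hf1

lemma IsMajor.off {u : V} (hu : IsMajor C u) (hW : Winds C n c) (k : ℤ) : u ≠ c k := fun h =>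
  hu.1 (h ▸ hW.mem_support k)

/-- A major vertex has a neighbour outside the three-vertex path centred at `c m`. -/
lemma IsMajor.exists_far {u : V} (hu : IsMajor C u) (hW : Winds C n c) (hn : 3 ≤ n) (m : ℤ) :
    ∃ k, m + 1 < k ∧ k + 1 < m + n ∧ G.Adj u (c k) := by
  by_contra hcon
  push Not at hcon
  obtain ⟨P, hP, hA⟩ := hW.exists_walk (i := m - 1) (j := m + 1) (by omega) (by omega)
  refine hu.2 ⟨_, _, P, hP, by have := hA.length; omega, fun w hw h => ?_⟩
  obtain ⟨k, rfl⟩ := (hW.supp w).1 hw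
  obtain ⟨k', h1, h2, h3⟩ := hW.normalize (by omega) (m - 1) k
  have h4 := h3 0
  simp only [add_zero] at h4
  rw [← h4] at h ⊢
  rw [hA.supp]
  refine ⟨k', h1, ?_, rfl⟩
  by_contra h5
  exact hcon k' (by omega) (by omega) h

lemma ncard_arcs_le (L : List (ℤ × ℤ)) (hL : ∀ I ∈ L, I.1 ≤ I.2) :
    {w : V | ∃ I ∈ L, ∃ k, I.1 ≤ k ∧ k ≤ I.2 ∧ c k = w}.Finite ∧
    ({w : V | ∃ I ∈ L, ∃ k, I.1 ≤ k ∧ k ≤ I.2 ∧ c k = w}.ncard : ℤ) ≤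
      (L.map fun I => I.2 - I.1 + 1).sum := by
  induction L with
  | nil => simp
  | cons I L ih =>
    obtain ⟨hfin, hcard⟩ := ih fun I hI => hL I (List.mem_cons_of_mem _ hI)
    have e : {w : V | ∃ J ∈ I :: L, ∃ k, J.1 ≤ k ∧ k ≤ J.2 ∧ c k = w} =
        c '' Set.Icc I.1 I.2 ∪ {w : V | ∃ I ∈ L, ∃ k, I.1 ≤ k ∧ k ≤ I.2 ∧ c k = w} := by
      ext w
      simp only [List.mem_cons, Set.mem_ofPred_eq, Set.mem_union, Set.mem_image, Set.mem_Icc,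
        exists_eq_or_imp, and_assoc]
    have hI := hL I List.mem_cons_self
    have hIf : (Set.Icc I.1 I.2).Finite := Set.finite_Icc _ _
    have h1 : ((c '' Set.Icc I.1 I.2).ncard : ℤ) ≤ I.2 - I.1 + 1 := by
      have h2 := Set.ncard_image_le (f := c) hIf
      have h3 : (Set.Icc I.1 I.2).ncard = (I.2 + 1 - I.1).toNat := by
        rw [← Finset.coe_Icc, Set.ncard_coe_finset, Int.card_Icc]
      omega
    rw [e]
    refine ⟨(hIf.image c).union hfin, ?_⟩
    have := Set.ncard_union_le (c '' Set.Icc I.1 I.2)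
      {w : V | ∃ I ∈ L, ∃ k, I.1 ≤ k ∧ k ≤ I.2 ∧ c k = w}
    rw [List.map_cons, List.sum_cons]
    omega

/-- Arcs that catch all vertices of a set off the cycle yield a set of paths of `C`. -/
lemma exists_paths_of_arcs (hW : Winds C n c) {M : Set V} (hM : ∀ u ∈ M, ∀ k, u ≠ c k) {m : ℕ}
    (L : List (ℤ × ℤ)) (hL : ∀ I ∈ L, I.1 ≤ I.2 ∧ I.2 < I.1 + n)
    (hsum : (L.map fun I => I.2 - I.1 + 1).sum ≤ (m : ℤ)) (hcatch : ∀ w ∈ M, ∃ I ∈ L, Caught G c w I) :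
    ∃ F : Set (Σ a b : V, G.Walk a b), (∀ P ∈ F, IsPathOf C P.2.2) ∧ cost F ≤ m ∧
      ∀ v ∈ M, ∃ P ∈ F, Catches P.2.2 v := by
  refine ⟨{P | ∃ I ∈ L, P.1 = c I.1 ∧ P.2.1 = c I.2 ∧ IsPathOf C P.2.2 ∧
    IsArc n c P.2.2 I.1 I.2}, ?_, ?_, ?_⟩
  · rintro P ⟨I, -, -, -, hP, -⟩
    exact hP
  · obtain ⟨hfin, hcard⟩ := ncard_arcs_le (c := c) L fun I hI => (hL I hI).1
    have hsub : {w : V | ∃ P ∈ {P : Σ a b : V, G.Walk a b | ∃ I ∈ L, P.1 = c I.1 ∧ P.2.1 = c I.2 ∧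
        IsPathOf C P.2.2 ∧ IsArc n c P.2.2 I.1 I.2}, w ∈ P.2.2.support} ⊆
        {w : V | ∃ I ∈ L, ∃ k, I.1 ≤ k ∧ k ≤ I.2 ∧ c k = w} := by
      rintro w ⟨P, ⟨I, hI, -, -, -, hA⟩, hw⟩
      exact ⟨I, hI, (hA.supp w).1 hw⟩
    have := Set.ncard_le_ncard hsub hfin
    unfold cost
    omega
  · intro v hv
    obtain ⟨I, hI, k, h1, h2, h3⟩ := hcatch v hv
    obtain ⟨P, hP, hA⟩ := hW.exists_walk (hL I hI).1 (hL I hI).2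
    refine ⟨⟨_, _, P⟩, ⟨I, hI, rfl, rfl, hP, hA⟩, ?_, c k, ⟨?_, ?_, ?_⟩, h3⟩
    · rw [hA.supp]
      rintro ⟨k, -, -, h⟩
      exact hM v hv k h.symm
    · exact (hA.supp _).2 ⟨k, h1.le, h2.le, rfl⟩
    · exact (hW.ne _ _ h1 (by have := (hL I hI).2; omega)).symm
    · exact hW.ne _ _ h2 (by have := (hL I hI).2; omega)

end LongOddHole

/-! ### Consequences of a remote base, and the theorem. -/

namespace LongOddHole

open SimpleGraph

variable {V : Type*} {G : SimpleGraph V} {c₀ : V} {C : G.Walk c₀ c₀} {n : ℤ} {c : ℤ → V}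

lemma IsArc.shift {a b : V} {P : G.Walk a b} {i j : ℤ} (hA : IsArc n c P i j) :
    IsArc n (fun k => c (i + k)) P 0 (j - i) := by
  have hle := hA.le
  have hlt := hA.lt
  refine ⟨by omega, by omega, ?_, fun w => ?_, fun v w => ?_, by rw [hA.length]; ring⟩
  · simpa using hA.ends
  · rw [hA.supp]
    constructor
    · rintro ⟨k, h1, h2, rfl⟩
      exact ⟨k - i, by omega, by omega, by simp⟩
    · rintro ⟨k, h1, h2, rfl⟩
      exact ⟨i + k, by omega, by omega, rfl⟩
  · rw [hA.edges]
    constructor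
    · rintro ⟨k, h1, h2, h3⟩
      refine ⟨k - i, by omega, by omega, ?_⟩
      rw [← h3, add_sub_cancel, show i + (k - i + 1) = k + 1 by ring]
    · rintro ⟨k, h1, h2, h3⟩
      refine ⟨i + k, by omega, by omega, ?_⟩
      rw [← h3, add_assoc]

lemma IsPathOf.reverse {a b : V} {P : G.Walk a b} (hP : IsPathOf C P) : IsPathOf C P.reverse := by
  obtain ⟨h1, h2, h3⟩ := hP
  refine ⟨h1.reverse, ?_, ?_⟩
  · rw [Walk.support_reverse]
    exact fun w hw => h2 (List.mem_reverse.1 hw)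
  · rw [Walk.edges_reverse]
    exact fun w hw => h3 (List.mem_reverse.1 hw)

section RemoteBase

variable {ℓ : ℕ} {x : V} {d₁ d₂ : V} {D : G.Walk d₁ d₂} {δ : ℤ}

lemma IsSpanned.of_arc {u a b : V} {P : G.Walk a b} {i j : ℤ}
    (hP : IsPathOf C P) (hA : IsArc n c P i j) (hi : G.Adj u (c i)) (hj : G.Adj u (c j))
    (hd : ∀ k, i < k → k < j → ¬ G.Adj u (c k)) : IsSpanned C u P := by
  have hends := hA.ends
  refine ⟨hP, ?_, ?_, ?_⟩
  · rcases hends with ⟨h, -⟩ | ⟨h, -⟩ <;> rw [h] <;> assumption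
  · rcases hends with ⟨-, h⟩ | ⟨-, h⟩ <;> rw [h] <;> assumption
  · rintro w ⟨hw, h1, h2⟩
    obtain ⟨k, h3, h4, rfl⟩ := (hA.supp w).1 hw
    have h5 : k ≠ i := by
      rintro rfl
      rcases hends with ⟨h, -⟩ | ⟨-, h⟩
      · exact h1 h.symm
      · exact h2 h.symm
    have h6 : k ≠ j := by
      rintro rfl
      rcases hends with ⟨-, h⟩ | ⟨h, -⟩
      · exact h2 h.symm
      · exact h1 h.symm
    exact hd k (by omega) (by omega)

lemma IsSpanned.adj_ends {u a b : V} {P : G.Walk a b} {i j : ℤ} (hP : IsSpanned C u P)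
    (hA : IsArc n c P i j) : G.Adj u (c i) ∧ G.Adj u (c j) := by
  rcases hA.ends with ⟨h1, h2⟩ | ⟨h1, h2⟩ <;> rw [← h1, ← h2]
  · exact ⟨hP.2.1, hP.2.2.1⟩
  · exact ⟨hP.2.2.1, hP.2.1⟩

lemma IsSpanned.not_adj {u a b : V} {P : G.Walk a b} {i j : ℤ} (hW : Winds C n c)
    (hP : IsSpanned C u P) (hA : IsArc n c P i j) {k : ℤ} (h1 : i < k) (h2 : k < j) :
    ¬ G.Adj u (c k) := by
  have hlt := hA.lt
  have h3 := hW.ne i k h1 (by omega)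
  have h4 := hW.ne k j h2 (by omega)
  refine hP.2.2.2 (c k) ⟨(hA.supp _).2 ⟨k, by omega, by omega, rfl⟩, ?_, ?_⟩
  · rcases hA.ends with ⟨h, -⟩ | ⟨h, -⟩ <;> rw [h]
    · exact h3.symm
    · exact h4
  · rcases hA.ends with ⟨-, h⟩ | ⟨-, h⟩ <;> rw [h]
    · exact h4
    · exact h3.symm

/-- The arcs from `c k` to the positions 0, `δ` and `n` are paths of `C` ending at ends of `D`, so
none is shorter than `ℓ`. Position `n` is included because it represents the same vertex as 0. -/
lemma IsRemoteBase.far (hD : IsRemoteBase ℓ C x D) (hW : Winds C n c) (hA : IsArc n c D 0 δ)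
    (hn : 2 * ℓ < n) {y : V} (hy : IsMajor C y) (hyx : y ≠ x) {k : ℤ} (h0 : 0 ≤ k) (hk : k ≤ n)
    (hadj : G.Adj y (c k)) : ℓ ≤ k ∧ k + ℓ ≤ n ∧ (k + ℓ ≤ δ ∨ δ + ℓ ≤ k) := by
  have hδ := hA.le
  have hrem := hD.2.2 y hy hyx (c k) (hW.mem_support k) hadj
  have key : ∀ m, (c m = c 0 ∨ c m = c δ) → ∀ P : G.Walk (c k) (c m), IsPathOf C P →
      ¬ P.length < ℓ := by
    intro m hm P hP hlt
    have hex : ∃ P : G.Walk (c k) (c m), IsPathOf C P ∧ P.length < ℓ := ⟨P, hP, hlt⟩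
    rcases hA.ends with ⟨e1, e2⟩ | ⟨e1, e2⟩ <;> rw [e1, e2] at hrem <;> rcases hm with hm | hm <;>
      rw [hm] at hex
    · exact hrem.1 hex
    · exact hrem.2 hex
    · exact hrem.2 hex
    · exact hrem.1 hex
  have up : ∀ m, (c m = c 0 ∨ c m = c δ) → k ≤ m → k + ℓ ≤ m := by
    intro m hm hkm
    by_contra h
    obtain ⟨P, hP, hPA⟩ := hW.exists_walk hkm (by omega)
    exact key m hm P hP (by have := hPA.length; omega)
  have down : ∀ m, (c m = c 0 ∨ c m = c δ) → m ≤ k → m + ℓ ≤ k := by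
    intro m hm hkm
    by_contra h
    obtain ⟨P, hP, hPA⟩ := hW.exists_walk hkm (by omega)
    exact key m hm P.reverse hP.reverse (by have := hPA.length; rw [Walk.length_reverse]; omega)
  have hn0 : c n = c 0 := by
    have := hW.per 0
    rwa [zero_add] at this
  have h1 := down 0 (Or.inl rfl) h0
  have h2 := up n (Or.inl hn0) hk
  refine ⟨by omega, h2, ?_⟩
  rcases le_total k δ with h3 | h3
  · exact Or.inl (up δ (Or.inr rfl) h3)
  · exact Or.inr (down δ (Or.inr rfl) h3)

/-- By the maximality of `D`, every other major vertex has a neighbour in `D`. -/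
lemma IsRemoteBase.meets (hD : IsRemoteBase ℓ C x D) (hW : Winds C n c) (hA : IsArc n c D 0 δ)
    (hn : 2 * ℓ < n) (hn3 : 3 ≤ n) {y : V} (hy : IsMajor C y) (hyx : y ≠ x) :
    ∃ k, 0 ≤ k ∧ k ≤ δ ∧ G.Adj y (c k) := by
  by_contra hcon
  push Not at hcon
  have hδ := hA.le
  have hlt := hA.lt
  have hback : ∀ k, G.Adj y (c k) → G.Adj y (c (k - n)) := by
    intro k h
    have := hW.per (k - n)
    rw [sub_add_cancel] at this
    rwa [← this]
  have hex : ∃ k, δ ≤ k ∧ k ≤ n ∧ G.Adj y (c k) := by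
    obtain ⟨k, h1, h2, h3⟩ := hy.exists_far hW hn3 0
    refine ⟨k, ?_, by omega, h3⟩
    by_contra h
    exact hcon k (by omega) (by omega) h3
  obtain ⟨g₂, a1, a2, a3, a4⟩ := exists_least hex
  obtain ⟨g₁, b1, b2, b3, b4⟩ := exists_greatest hex
  have f₂ := hD.far hW hA hn hy hyx (by omega) a2 a3
  have f₁ := hD.far hW hA hn hy hyx (by omega) b2 b3
  have hg2δ : g₂ ≠ δ := fun h => hcon g₂ (by omega) (by omega) a3
  have hg1n : g₁ ≠ n := fun h => by
    have h1 := hback g₁ b3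
    rw [h, sub_self] at h1
    exact hcon 0 le_rfl hδ h1
  have h12 : g₂ < g₁ := by
    obtain ⟨k, h1, h2, h3⟩ := hy.exists_far hW hn3 g₂
    by_contra h
    by_cases h4 : k ≤ n
    · exact b4 k (by omega) h4 h3
    · have h5 := hback k h3
      by_cases h6 : k - n ≤ δ
      · exact hcon (k - n) (by omega) h6 h5
      · exact a4 (k - n) (by omega) (by omega) h5
  -- This arc runs from the last outer neighbour of `y` across `D`, now at `[n, n + δ]`, to the
  -- first one. It properly contains `D` and is spanned by `y`.
  obtain ⟨E, hE, hEA⟩ := hW.exists_walk (i := g₁) (j := g₂ + n) (by omega) (by omega)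
  have hspan : IsSpanned C y E := by
    refine IsSpanned.of_arc hE hEA b3 (by rwa [hW.per]) fun k h1 h2 h => ?_
    by_cases h3 : k ≤ n
    · exact b4 k h1 h3 h
    · have h4 := hback k h
      by_cases h5 : k - n ≤ δ
      · exact hcon (k - n) (by omega) h5 h4
      · exact a4 (k - n) (by omega) (by omega) h4
  have hmax := hD.1.2.2 y _ _ E hy hspan ?_ ?_
  · have h1 := hEA.length
    have h2 := hA.length
    omega
  · intro w hw
    obtain ⟨k, h1, h2, rfl⟩ := (hA.supp w).1 hw
    exact (hEA.supp _).2 ⟨k + n, by omega, by omega, hW.per k⟩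
  · intro e he
    induction e with
    | _ v w =>
      obtain ⟨k, h1, h2, h3⟩ := (hA.edges v w).1 he
      refine (hEA.edges v w).2 ⟨k + n, by omega, by omega, ?_⟩
      rw [← h3, hW.per, add_right_comm, hW.per]

end RemoteBase

end LongOddHole

open LongOddHole in
theorem theorem6p1 {V : Type*} [Finite V] (G : SimpleGraph V) (ℓ : ℕ) (hℓ : 5 ≤ ℓ)
    (hG : LongOddHole.IsCandidate G ℓ)
    {c : V} (C : G.Walk c c) (hC : LongOddHole.IsShortestLongOddHole ℓ C)
    (x : V) {d₁ d₂ : V} (D : G.Walk d₁ d₂) (hD : LongOddHole.IsRemoteBase ℓ C x D)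
    (M : Set V) (hM : ∀ v ∈ M, LongOddHole.IsMajor C v) (hMx : ∀ v ∈ M, ¬ G.Adj x v)
    (hpar : ∃ p : ZMod 2, ∀ v ∈ M, LongOddHole.HasXParity C x v p)
    (v₁ v₂ : V) (hv₁ : v₁ ∈ M) (hv₂ : v₂ ∈ M) (hv : G.Adj v₁ v₂)
    {q₁ q₂ : V} (Q : G.Walk q₁ q₂) (hQ : LongOddHole.IsGap C v₁ v₂ Q) (hQodd : Odd Q.length)
    (hq₁ : G.Adj v₁ q₁) (hq₂ : G.Adj v₂ q₂)
    (hQD : ∀ e ∈ Q.edges, e ∉ D.edges)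
    (hxQ : ∃ w ∈ Q.support, G.Adj x w)
    (hMQ : ∀ v ∈ M, ∃ w ∈ Q.support, G.Adj v w) :
    ∃ F : Set (Σ a b : V, G.Walk a b),
      (∀ P ∈ F, LongOddHole.IsPathOf C P.2.2) ∧
      LongOddHole.cost F ≤ 5 * ℓ + 12 ∧
      ∀ v ∈ M, ∃ P ∈ F, LongOddHole.Catches P.2.2 v := by
  obtain ⟨c', hW'⟩ := exists_winds hC.1.1.1
  obtain ⟨n, hn⟩ : ∃ n : ℤ, n = C.length := ⟨_, rfl⟩
  rw [← hn] at hW'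
  have hnl : 2 * ℓ + 3 ≤ n := by
    by_contra h
    exact hG.2.2 ⟨_, C, hC.1, by omega⟩
  have hnodd : Odd n := by
    rw [hn, Int.odd_coe_nat]
    exact hC.1.2.2
  obtain ⟨i₀, j₀, hA₀⟩ := hW'.exists_isArc (by omega) D hD.1.2.1.1
  have hW := hW'.shift i₀
  have hA := hA₀.shift
  generalize (fun k => c' (i₀ + k)) = c at hW hA
  generalize j₀ - i₀ = δ at hA
  have hδle := hA.le
  have hδlt := hA.lt
  have hδ2 : 2 * ℓ ≤ δ := by
    have h1 := hA.length
    have h2 := hD.2.1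
    omega
  have hcyc := hW.cycleMap (by omega) hC.1.1.2.1
  have heven : HolesEven G ℓ n := fun S a b z k h1 h2 h3 h4 h5 h6 h7 h8 =>
    hC.even_of_closing h1 h2 h3 h4 h5 h6 h7 (by omega)
  have hxoff := hD.1.1.off hW
  obtain ⟨hx0, hxδ⟩ := hD.1.2.1.adj_ends hA
  have hxin : ∀ k, 0 < k → k < δ → ¬ G.Adj x (c k) := fun k h1 h2 =>
    hD.1.2.1.not_adj hW hA h1 h2
  -- Being major, `x` has a neighbour at one of the positions `1, …, n - 3`, and it has none
  -- strictly between 0 and `δ`.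
  have hδn : δ + 3 ≤ n := by
    obtain ⟨k, h1, h2, h3⟩ := hD.1.1.exists_far hW (by omega) (n - 1)
    by_contra h
    have h4 := hW.per (k - n)
    rw [sub_add_cancel] at h4
    rw [h4] at h3
    exact hxin (k - n) (by omega) (by omega) h3
  have hS : Setup G ℓ n δ c x :=
    ⟨hcyc, hG.1, hG.2.1, heven, hxoff, hx0, hxδ, hxin, hℓ, hδ2, hδn⟩
  have hδe : Even δ := by
    have := heven.spanned hcyc hxoff hx0 hxδ hxin (by omega) (by omega) (by omega)
    simpa using this
  obtain ⟨p, hp⟩ := hpar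
  have hne : ∀ u ∈ M, u ≠ x := by
    intro u hu
    obtain ⟨a, b, P, hg, -⟩ := hp u hu
    exact hg.1.symm
  have hmem : ∀ u ∈ M, Member G ℓ n δ c x u := fun u hu =>
    ⟨(hM u hu).off hW, hne u hu, hMx u hu, fun k h1 h2 h3 =>
      hD.far hW hA (by omega) (hM u hu) (hne u hu) h1 h2 h3,
      hD.meets hW hA (by omega) (by omega) (hM u hu) (hne u hu)⟩
  obtain ⟨s, t, s1, s2, hQA⟩ := hW.exists_isArc_from (by omega) Q hQ.2.1 0
  have hQle := hQA.le
  have hQlen := hQA.length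
  have hodd : Odd (t - s) := by
    rw [← hQlen, Int.odd_coe_nat]
    exact hQodd
  have hst : s < t := by
    rw [Int.odd_iff] at hodd
    omega
  have hsδ : δ ≤ s := by
    by_contra h
    exact hQD _ ((hQA.edges _ _).2 ⟨s, le_rfl, hst, rfl⟩)
      ((hA.edges _ _).2 ⟨s, s1, by omega, rfl⟩)
  have htn : t ≤ n := by
    by_contra h
    refine hQD _ ((hQA.edges _ _).2 ⟨n, by omega, by omega, rfl⟩)
      ((hA.edges _ _).2 ⟨0, le_rfl, by omega, ?_⟩)
    have h1 := hW.per 0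
    have h2 := hW.per 1
    rw [zero_add] at h1
    rw [h1, zero_add, add_comm n, h2]
  obtain ⟨a, b, hgap⟩ := hQ.exists_arcGap hW (by omega) hQA
  have hends := hgap.ends
  -- The ends of the odd gap are neighbours of members; remoteness thus sharpens `δ ≤ s` and `t ≤ n`
  -- by `ℓ`.
  have fa := (hmem v₁ hv₁).far a (by omega) (by omega) hgap.adj_left
  have fb := (hmem v₂ hv₂).far b (by omega) (by omega) hgap.adj_right
  have hx' : ∃ k, s ≤ k ∧ k ≤ t ∧ G.Adj x (c k) := by
    obtain ⟨w, hw, h⟩ := hxQ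
    obtain ⟨k, h1, h2, rfl⟩ := (hQA.supp w).1 hw
    exact ⟨k, h1, h2, h⟩
  have hM' : ∀ u ∈ M, ∃ k, s ≤ k ∧ k ≤ t ∧ G.Adj u (c k) := by
    intro u hu
    obtain ⟨w, hw, h⟩ := hMQ u hu
    obtain ⟨k, h1, h2, rfl⟩ := (hQA.supp w).1 hw
    exact ⟨k, h1, h2, h⟩
  have hfam : Family G ℓ n δ c x M (p = 0) := by
    refine hS.family hδe hnodd hmem (fun u hu => ?_) fun u hu => ?_
    · obtain ⟨k, h1, h2, h3⟩ := hM' u hu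
      exact ⟨k, by omega, by omega, h3⟩
    · obtain ⟨a, b, P, hg, hlen⟩ := hp u hu
      obtain ⟨i, j, h1, h2, hPA⟩ := hW.exists_isArc_from (by omega) P hg.2.1 0
      obtain ⟨a, b, hI⟩ := hg.exists_arcGap hW (by omega) hPA
      refine ⟨i, j, a, b, h1, by omega, hPA.lt, hI, ?_⟩
      rw [← hlen, ZMod.natCast_eq_zero_iff_even, ← hPA.length, Int.even_coe_nat]
  -- `Q` may traverse its arc in either direction, in which case `v₁` and `v₂` are exchanged.
  have hQ' : ∃ v₁ v₂, OddGap G ℓ n δ c x M s t v₁ v₂ := by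
    rcases hends with ⟨rfl, rfl⟩ | ⟨rfl, rfl⟩
    · exact ⟨v₁, v₂, by omega, by omega, hodd, hv₁, hv₂, hv, hgap, hx', hM'⟩
    · exact ⟨v₂, v₁, by omega, by omega, hodd, hv₂, hv₁, hv.symm, hgap.symm, hx', hM'⟩
  obtain ⟨u₁, u₂, hQ'⟩ := hQ'
  obtain ⟨L, hL, hsum, hcatch⟩ := hS.exists_catching_arcs hfam hQ'
  exact exists_paths_of_arcs hW (fun u hu => (hmem u hu).off) L hL (by push_cast; exact hsum) hcatch
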